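/- Let $G$ be a finite undirected multigraph with node set $N$, let $T\subseteq N$ be a set of terminals, and let $S$ be the edge set of a simple graph on $T$. Let $\mathcal K$ be the set of anticliques, i.e. inclusion-maximal stable sets, of $(T,S)$. Assume that $(G,T,\mathcal K)$ is a K-network: every node of $N\setminus T$ has even degree, and any distinct pairwise intersecting $A,B,C\in\mathcal K$ satisfy $A\cap B=A\cap C=B\cap C$. For distinct terminals put $\omega(u,v)=1$ if $(u,v)\in S$, $\omega(u,v)=\frac12$ if exactly one member of $\mathcal K$ contains both $u$ and $v$, and $\omega(u,v)=0$ otherwise; in the last case write $u\sim v$ (a zero pair). A fractional multiflow $f$ assigns non-negative weights to the paths of $G$ joining two distinct terminals, so that the total weight of the paths through $(x,y)$ is at most the number of $(x,y)$-edges, for each pair of adjacent nodes $x,y$; $\Theta(f)$ is the sum over all paths $P$ of $f(P)\,\omega(u,v)$, where $u,v$ are the ends of $P$, and $\theta=\max_f\Theta(f)$. For $X\subseteq N$ let $d(X)$ be the number of edges between $X$ and $N\setminus X$; for $A\subseteq T$ let $\lambda(A)=\min\{d(X):X\cap T=A\}$ and $\beta(A)=\frac12\bigl(\sum_{t\in A}\lambda(\{t\})-\lambda(A)\bigr)$.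 An expansion is a family $\mathcal X$ of pairwise disjoint node sets whose traces $X\cap T$, $X\in\mathcal X$, are the blocks of a partition of $T$ into non-empty sets such that any two distinct terminals in a common block form a zero pair. Contracting each member of $\mathcal X$ to a single node gives a network with graph $G_{\mathcal X}$ and terminal set $\mathcal X$, in which two members $X,Y$ form a demand pair if $(s,t)\in S$ for all $s\in X\cap T$, $t\in Y\cap T$; $\mathcal K_{\mathcal X}$ is its set of anticliques and $\theta_{\mathcal X}$ its maximum of $\Theta$, both defined as for the original network. Write $\mathcal X\preceq\mathcal Y$ if every member of $\mathcal X$ is contained in a member of $\mathcal Y$. The expansion $\mathcal X$ is critical if $\theta_{\mathcal Y}>\theta_{\mathcal X}$ for every expansion $\mathcal Y\succ\mathcal X$, and a dual solution if moreover $\theta_{\mathcal X}=\theta$. Put $$v(\mathcal X)=\tfrac12\sum_{X\in\mathcal X}d(X)-\tfrac12\sum_{A\in\mathcal K_{\mathcal X}}\beta(A),$$ where $\beta(A)$ is computed in the contracted network. Then the maximum $\theta$ of $\Theta(f)$ over the fractional multiflows is attained, and the following hold. 1. If $\mathcal K$ is simple (any two distinct terminals are separated by some member of $\mathcal K$), then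 $\theta=\min_{\mathcal X}v(\mathcal X)$, the minimum being over all expansions and attained. 2. For an arbitrary K-network, $\theta=\min_{\mathcal X}v(\mathcal X)$, where $\mathcal X$ runs over the expansions in which every zero pair lies in a common member (for simple $\mathcal K$ these are all expansions); the minimum is attained. 3. $v(\mathcal X)=\theta$ for every dual solution $\mathcal X$. -/

import Mathlib

open scoped Classical

/-- A network `(G, T, S)`. The finite undirected multigraph `G` on the node set `V` is given by its
edge multiplicities (`mult x y` is the number of `(x, y)`-edges; loops play no role for paths
and cuts and are left out), `T` is the set of terminals, and the demand graph (scheme) `S` is a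
simple graph all of whose edges join terminals. -/
structure Network (V : Type*) where
  mult : V → V → ℕ
  mult_symm : ∀ x y, mult x y = mult y x
  mult_self : ∀ x, mult x x = 0
  T : Finset V
  S : SimpleGraph V
  S_mem : ∀ ⦃u v⦄, S.Adj u v → u ∈ T

namespace Network

noncomputable section

variable {V : Type*} [Fintype V]

/-- The simple graph of adjacent pairs of nodes of `G`. -/
def graph (N : Network V) : SimpleGraph V where
  Adj x y := 0 < N.mult x y
  symm := ⟨fun x y h => by rw [N.mult_symm]; exact h⟩
  loopless := ⟨fun x h => by simp [N.mult_self] at h⟩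

/-- The clutter `𝒦` of anticliques: the inclusion-maximal stable sets of `(T, S)`. -/
def anticliques (N : Network V) : Finset (Finset V) :=
  Finset.univ.filter
    (Maximal fun A : Finset V => A ⊆ N.T ∧ ∀ u ∈ A, ∀ v ∈ A, ¬ N.S.Adj u v)

/-- The number of anticliques covering the pair `(u, v)`. -/
def coverNumber (N : Network V) (u v : V) : ℕ :=
  (N.anticliques.filter fun A => u ∈ A ∧ v ∈ A).card

/-- Any distinct pairwise intersecting anticliques `A, B, C` satisfy
`A ∩ B = A ∩ C = B ∩ C`. -/
def IsKClutter (N : Network V) : Prop :=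
  ∀ A ∈ N.anticliques, ∀ B ∈ N.anticliques, ∀ C ∈ N.anticliques,
    A ≠ B → A ≠ C → B ≠ C →
    (A ∩ B).Nonempty → (A ∩ C).Nonempty → (B ∩ C).Nonempty →
    A ∩ B = A ∩ C ∧ A ∩ C = B ∩ C

/-- Every inner (non-terminal) node has even degree. -/
def IsEulerian (N : Network V) : Prop :=
  ∀ v, v ∉ N.T → Even (∑ y, N.mult v y)

/-- A K-network: Eulerian, with an anticlique clutter that is a K-clutter. -/
def IsKNetwork (N : Network V) : Prop :=
  N.IsEulerian ∧ N.IsKClutter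

/-- The clutter of anticliques is simple: terminals not separated by any anticlique coincide. -/
def IsSimple (N : Network V) : Prop :=
  ∀ s ∈ N.T, ∀ t ∈ N.T, (∀ A ∈ N.anticliques, s ∈ A ↔ t ∈ A) → s = t

/-- The reward function `ω` of the `W`-problem (used for pairs of distinct terminals). -/
def reward (N : Network V) (u v : V) : ℝ :=
  if N.S.Adj u v then 1 else if N.coverNumber u v = 1 then 1 / 2 else 0

/-- `(s, t)` is a zero pair, `s ∼ t`: distinct terminals covered by at least two anticliques. -/
def IsZeroPair (N : Network V) (s t : V) : Prop :=
  s ≠ t ∧ 2 ≤ N.coverNumber s t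

/-- A `T`-path: a path of `G` whose ends are two distinct terminals (it may traverse further
terminals). A path and its reverse are listed separately; this does not matter, as the capacity
constraints and `Θ` only see their total weight. -/
def TPath (N : Network V) : Type _ :=
  Σ e : {e : V × V // e.1 ∈ N.T ∧ e.2 ∈ N.T ∧ e.1 ≠ e.2}, N.graph.Path e.1.1 e.1.2

instance (N : Network V) : Fintype N.TPath :=
  inferInstanceAs (Fintype (Σ e : {e : V × V // e.1 ∈ N.T ∧ e.2 ∈ N.T ∧ e.1 ≠ e.2},
    N.graph.Path e.1.1 e.1.2))

/-- First end of a `T`-path. -/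
def TPath.fst {N : Network V} (P : N.TPath) : V := P.1.1.1

/-- Last end of a `T`-path. -/
def TPath.snd {N : Network V} (P : N.TPath) : V := P.1.1.2

/-- `I(P, (x, y))`: the number of `(x, y)`-edges traversed by `P`. -/
def TPath.traversals {N : Network V} (P : N.TPath) (x y : V) : ℕ :=
  P.2.1.edges.count s(x, y)

/-- A fractional `T`-flow (multiflow): a non-negative weight function on the `T`-paths that
satisfies the edge capacity constraints. -/
def IsFlow (N : Network V) (f : N.TPath → ℝ) : Prop :=
  (∀ P, 0 ≤ f P) ∧
    ∀ x y, N.graph.Adj x y → ∑ P, f P * (P.traversals x y : ℝ) ≤ (N.mult x y : ℝ)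

/-- `Θ(f)`, the total reward of `f`: every path contributes its weight times the reward of its
end-pair. -/
def reward_flow (N : Network V) (f : N.TPath → ℝ) : ℝ :=
  ∑ P, f P * N.reward P.fst P.snd

/-- The set of all values `Θ(f)` of fractional `T`-flows. -/
def flowValues (N : Network V) : Set ℝ := {r | ∃ f, N.IsFlow f ∧ N.reward_flow f = r}

/-- `θ`, the maximum of the `W`-problem. -/
def theta (N : Network V) : ℝ := sSup N.flowValues

/-- `d(X)`, the number of edges between `X` and its complement. -/
def d (N : Network V) (X : Finset V) : ℕ := ∑ x ∈ X, ∑ y ∈ Xᶜ, N.mult x y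

/-- `λ(A)`, the minimum of `d(X)` over `X ⊆ V` with `X ∩ T = A`. -/
def lam (N : Network V) (A : Finset V) : ℕ := sInf {n | ∃ X : Finset V, X ∩ N.T = A ∧ N.d X = n}

/-- `β(A) = (∑_{t ∈ A} λ(t) - λ(A)) / 2`. -/
def beta (N : Network V) (A : Finset V) : ℝ :=
  (∑ t ∈ A, (N.lam {t} : ℝ) - N.lam A) / 2

/-- An expansion: a family of pairwise disjoint node sets `X` whose traces `α = X ∩ T` form an
equi-partition of `T`, i.e. a partition with any two distinct terminals in the same block forming
a zero pair. The member with trace `α` is the set `X_α`. -/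
structure Expansion (N : Network V) where
  members : Finset (Finset V)
  disjoint : ∀ X ∈ members, ∀ Y ∈ members, X ≠ Y → Disjoint X Y
  nonempty : ∀ X ∈ members, (X ∩ N.T).Nonempty
  cover : ∀ t ∈ N.T, ∃ X ∈ members, t ∈ X
  equi : ∀ X ∈ members, ∀ s ∈ X ∩ N.T, ∀ t ∈ X ∩ N.T, s ≠ t → N.IsZeroPair s t

namespace Expansion

variable {N : Network V}

/-- Nodes are identified when they lie in a common member of the expansion. -/
def setoid (𝒳 : N.Expansion) : Setoid V where
  r u v := u = v ∨ ∃ X ∈ 𝒳.members, u ∈ X ∧ v ∈ X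
  iseqv :=
    { refl := fun _ => Or.inl rfl
      symm := by
        rintro u v (h | ⟨X, hX, hu, hv⟩)
        · exact Or.inl h.symm
        · exact Or.inr ⟨X, hX, hv, hu⟩
      trans := by
        rintro u v w (rfl | ⟨X, hX, hu, hv⟩) (rfl | ⟨Y, hY, hv', hw⟩)
        · exact Or.inl rfl
        · exact Or.inr ⟨Y, hY, hv', hw⟩
        · exact Or.inr ⟨X, hX, hu, hv⟩
        · by_cases hXY : X = Y
          · subst hXY
            exact Or.inr ⟨X, hX, hu, hw⟩
          · exact absurd hv' (Finset.disjoint_left.mp (𝒳.disjoint X hX Y hY hXY) hv) }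

/-- The nodes of `G_𝒳`: every member of `𝒳` is contracted into one node. -/
def Node (𝒳 : N.Expansion) : Type _ := Quotient 𝒳.setoid

/-- The node of `G_𝒳` that a node of `G` becomes. -/
def toNode (𝒳 : N.Expansion) (v : V) : 𝒳.Node := Quotient.mk 𝒳.setoid v

instance (𝒳 : N.Expansion) : Fintype 𝒳.Node := inferInstanceAs (Fintype (Quotient 𝒳.setoid))

/-- The network with graph `G_𝒳`, the members of `𝒳` as terminals, and the induced demands: two
members `X_α`, `X_β` form a demand pair when `(s, t) ∈ S` for every `s ∈ α` and `t ∈ β`. -/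
def network (𝒳 : N.Expansion) : Network 𝒳.Node where
  mult a b := if a = b then 0 else
    ∑ u ∈ Finset.univ.filter (fun u => 𝒳.toNode u = a),
      ∑ v ∈ Finset.univ.filter (fun v => 𝒳.toNode v = b), N.mult u v
  mult_symm a b := by
    by_cases h : a = b
    · simp [h]
    · rw [if_neg h, if_neg (Ne.symm h), Finset.sum_comm]
      exact Finset.sum_congr rfl fun v _ => Finset.sum_congr rfl fun u _ => N.mult_symm u v
  mult_self a := if_pos rfl
  T := N.T.image 𝒳.toNode
  S :=
    { Adj := fun a b => a ∈ N.T.image 𝒳.toNode ∧ b ∈ N.T.image 𝒳.toNode ∧ a ≠ b ∧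
        ∀ s ∈ N.T, ∀ t ∈ N.T, 𝒳.toNode s = a → 𝒳.toNode t = b → N.S.Adj s t
      symm := ⟨fun _ _ h => ⟨h.2.1, h.1, h.2.2.1.symm,
        fun s hs t ht hsb hta => (h.2.2.2 t ht s hs hta hsb).symm⟩⟩
      loopless := ⟨fun _ h => h.2.2.1 rfl⟩ }
  S_mem _ _ h := h.1

/-- `θ_𝒳`, the maximum of the `W`-problem in the network of `𝒳`. -/
def theta (𝒳 : N.Expansion) : ℝ := 𝒳.network.theta

/-- `(1/2) ∑_X d(X) - (1/2) ∑_A β(A)`, where `X` runs over the members of `𝒳` and `A` over the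
clutter `𝒦_𝒳` of the network of `𝒳`, in which `β` is taken. -/
def value (𝒳 : N.Expansion) : ℝ :=
  1 / 2 * ∑ X ∈ 𝒳.members, (N.d X : ℝ) -
    1 / 2 * ∑ A ∈ 𝒳.network.anticliques, 𝒳.network.beta A

/-- The partial order on expansions: every member of `𝒳` is contained in a member of `𝒴`. -/
def Precedes (𝒳 𝒴 : N.Expansion) : Prop :=
  ∀ X ∈ 𝒳.members, ∃ Y ∈ 𝒴.members, X ⊆ Y

/-- `𝒳` is critical: every strictly larger expansion `𝒴` has `θ_𝒴 > θ_𝒳`. -/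
def IsCritical (𝒳 : N.Expansion) : Prop :=
  ∀ 𝒴 : N.Expansion, 𝒳.Precedes 𝒴 → 𝒴 ≠ 𝒳 → 𝒳.theta < 𝒴.theta

/-- A dual solution: a critical expansion with `θ_𝒳 = θ`. -/
def IsDualSolution (𝒳 : N.Expansion) : Prop :=
  𝒳.IsCritical ∧ 𝒳.theta = N.theta

/-- No zero pair joins distinct members of `𝒳`, i.e. the blocks of its equi-partition are the full
classes of the relation `s = t ∨ s ∼ t`. (Every expansion has this property when the clutter
is simple.) -/
def IsReduced (𝒳 : N.Expansion) : Prop :=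
  ∀ s ∈ N.T, ∀ t ∈ N.T, N.IsZeroPair s t → ∃ X ∈ 𝒳.members, s ∈ X ∧ t ∈ X

end Expansion

end

end Network

/-! Linear programming duality gives `θ = min cost(m)` over the pseudo-metrics `m` on the nodes
that dominate the reward function on the terminals (`theta_le_cost`,
`exists_isDualMetric_cost_le`); the maximum exists since the flows form a compact set. A
contraction along an expansion restricts the dual to pseudo-metrics that vanish on the members, so
it does not lower the maximum (`theta_le_theta`). In a K-clutter two terminals that form a zero
pair lie in the same anticliques, so contraction preserves the anticliques, and a reduced expansion
leaves a network without zero pairs.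

For a network without zero pairs consider the frame, the graph in which a center is joined to all
anticliques and every anticlique to its members. In the absence of zero pairs its path metric, with
edges of length `1 / 4`, realizes the reward function on the terminals, so a map from the nodes to
the frame that fixes the terminals pulls it back to a feasible pseudo-metric. Two facts about such
maps carry the proof.

* A map to the frame built from minimum cuts around the anticliques costs no more than the value of
  the min-max formula for the singletons, hence `θ ≤ v(𝒳)` for reduced `𝒳` (`theta_le_cutValue`,
  `theta_le_value`). The smallest minimum cuts around disjoint anticliques are disjoint, so a node
  lies only in cuts of pairwise intersecting anticliques, and by the K-clutter condition these
  determine a position in the frame.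
* Every feasible pseudo-metric can be rounded to a map to the frame without raising its cost
  (`exists_frameMetric_cost_le`): each node gets two coordinates, computed from its distances to the
  nearest terminals, and a random threshold turns them into a position.

If `𝒳` is critical, it is reduced, because merging two members joined by a zero pair does not raise
`θ_𝒳` (`IsCritical.isReduced`). Moreover no dual optimum of its network identifies a terminal
with another node, as the nodes at distance zero from the terminals would form a larger expansion
with the same maximum. Thus an optimal map to the frame takes only the terminals to terminals, and
each terminal is by itself a minimum cut; for such a map the cost is at least the value of the
formula (`cutValue_le_cost_frameMetric`), so `v(𝒳) ≤ θ_𝒳` (`IsCritical.value_le_theta`). Finally,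
dual solutions exist: a maximal expansion with `θ_𝒳 = θ` is one (`exists_isDualSolution`). -/

namespace Network

noncomputable section

variable {V : Type*} [Fintype V] {N : Network V}

/-! ### Flows and pseudo-metrics: linear programming duality -/

/-- The cost `∑ mult(x, y) m(x, y)` of a length function `m`, summed over the unordered pairs of
nodes; the factor `1 / 2` accounts for the sum running over ordered pairs. -/
def cost (N : Network V) (m : V → V → ℝ) : ℝ := 1 / 2 * ∑ x, ∑ y, (N.mult x y : ℝ) * m x y

/-- The feasible solutions of the linear program dual to the `W`-problem: pseudo-metrics on the
node set that dominate the reward function on the pairs of distinct terminals. -/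
structure IsDualMetric (N : Network V) (m : V → V → ℝ) : Prop where
  self : ∀ x, m x x = 0
  symm : ∀ x y, m x y = m y x
  triangle : ∀ x y z, m x z ≤ m x y + m y z
  reward_le : ∀ s ∈ N.T, ∀ t ∈ N.T, s ≠ t → N.reward s t ≤ m s t

theorem IsDualMetric.nonneg {m : V → V → ℝ} (hm : N.IsDualMetric m) (x y : V) : 0 ≤ m x y := by
  have h := hm.triangle x y x
  rw [hm.self, hm.symm y x] at h
  linarith

theorem reward_nonneg (u v : V) : 0 ≤ N.reward u v := by
  unfold reward; split_ifs <;> norm_num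

theorem reward_le_one (u v : V) : N.reward u v ≤ 1 := by
  unfold reward; split_ifs <;> norm_num

theorem cost_mono {m m' : V → V → ℝ} (h : ∀ x y, 0 < N.mult x y → m x y ≤ m' x y) :
    N.cost m ≤ N.cost m' := by
  unfold cost
  refine mul_le_mul_of_nonneg_left (Finset.sum_le_sum fun x _ => Finset.sum_le_sum fun y _ => ?_)
    (by norm_num)
  rcases Nat.eq_zero_or_pos (N.mult x y) with h0 | h0
  · simp [h0]
  · exact mul_le_mul_of_nonneg_left (h x y h0) (by positivity)

/-- The length of a walk with respect to a length function. -/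
def walkLength {W : Type*} {G : SimpleGraph W} (L : W → W → ℝ) {u v : W} (p : G.Walk u v) : ℝ :=
  (p.darts.map fun d => L d.fst d.snd).sum

/-- The length of a walk, summed over the pairs of nodes it traverses. -/
theorem sum_count_mul_eq_walkLength {G : SimpleGraph V} {L : V → V → ℝ}
    (hL : ∀ x y, L x y = L y x) {u v : V} (p : G.Walk u v) :
    1 / 2 * ∑ x, ∑ y, (p.edges.count s(x, y) : ℝ) * L x y = walkLength L p := by
  induction p with
  | nil => simp [walkLength]
  | @cons u w v h p ih =>
    have hne : u ≠ w := h.ne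
    have hpt : ∀ x y : V, ((SimpleGraph.Walk.cons h p).edges.count s(x, y) : ℝ) * L x y =
        (p.edges.count s(x, y) : ℝ) * L x y +
          ((if x = u then if y = w then L x y else 0 else 0) +
            (if y = u then if x = w then L x y else 0 else 0)) := by
      intro x y
      rw [SimpleGraph.Walk.edges_cons, List.count_cons]
      have hiff : (s(u, w) == s(x, y)) = true ↔ (x = u ∧ y = w) ∨ (y = u ∧ x = w) := by
        rw [beq_iff_eq, Sym2.eq_iff]
        constructor <;> rintro (⟨h1, h2⟩ | ⟨h1, h2⟩) <;> simp [h1, h2]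
      simp only [hiff]
      push_cast
      rw [add_mul]
      congr 1
      simp only [← ite_and]
      by_cases hP : x = u ∧ y = w
      · have hQ : ¬ (y = u ∧ x = w) := fun h => hne (hP.1.symm.trans h.2)
        rw [if_pos (Or.inl hP), if_pos hP, if_neg hQ, one_mul, add_zero]
      · by_cases hQ : y = u ∧ x = w
        · rw [if_pos (Or.inr hQ), if_neg hP, if_pos hQ, one_mul, zero_add]
        · rw [if_neg (by tauto), if_neg hP, if_neg hQ, zero_mul, add_zero]
    simp only [hpt, Finset.sum_add_distrib, mul_add, ih]
    rw [Finset.sum_comm (f := fun x y => if y = u then if x = w then L x y else 0 else 0)]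
    simp [walkLength, hL w u]
    ring

theorem le_walkLength {m : V → V → ℝ} (hm : N.IsDualMetric m) {G : SimpleGraph V} {u v : V}
    (p : G.Walk u v) : m u v ≤ walkLength m p := by
  induction p with
  | nil => simp [walkLength, hm.self]
  | @cons u w v h p ih =>
    have := hm.triangle u w v
    simp only [walkLength, SimpleGraph.Walk.darts_cons, List.map_cons, List.sum_cons] at ih ⊢
    linarith

/-- Weak duality. -/
theorem reward_flow_le_cost {m : V → V → ℝ} (hm : N.IsDualMetric m) {f : N.TPath → ℝ}
    (hf : N.IsFlow f) : N.reward_flow f ≤ N.cost m := by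
  have h1 : ∀ P : N.TPath, f P * N.reward P.fst P.snd ≤
      f P * (1 / 2 * ∑ x, ∑ y, (P.traversals x y : ℝ) * m x y) := by
    intro P
    refine mul_le_mul_of_nonneg_left ?_ (hf.1 P)
    calc N.reward P.fst P.snd ≤ m P.fst P.snd :=
          hm.reward_le _ P.1.2.1 _ P.1.2.2.1 P.1.2.2.2
      _ ≤ walkLength m P.2.1 := le_walkLength hm P.2.1
      _ = _ := (sum_count_mul_eq_walkLength hm.symm P.2.1).symm
  have h2 : ∑ P, f P * (1 / 2 * ∑ x, ∑ y, (P.traversals x y : ℝ) * m x y) =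
      1 / 2 * ∑ x, ∑ y, (∑ P, f P * (P.traversals x y : ℝ)) * m x y := by
    simp only [Finset.mul_sum, Finset.sum_mul]
    rw [Finset.sum_comm]
    refine Finset.sum_congr rfl fun x _ => ?_
    rw [Finset.sum_comm]
    exact Finset.sum_congr rfl fun y _ => Finset.sum_congr rfl fun P _ => by ring
  unfold reward_flow cost
  refine (Finset.sum_le_sum fun P _ => h1 P).trans (h2.le.trans ?_)
  gcongr with x _ y _
  · exact hm.nonneg x y
  · by_cases hxy : N.graph.Adj x y
    · exact hf.2 x y hxy
    · have h0 : ∀ P : N.TPath, P.traversals x y = 0 := fun P =>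
        List.count_eq_zero_of_not_mem fun h => hxy (P.2.1.adj_of_mem_edges h)
      simp [h0]

theorem isFlow_zero : N.IsFlow fun _ => 0 := by
  refine ⟨fun _ => le_rfl, fun x y _ => ?_⟩
  simp

/-- The set of flows is compact: every path traverses an edge, whose multiplicity bounds the
weight of the path. -/
theorem isCompact_setOf_isFlow (N : Network V) : IsCompact {f : N.TPath → ℝ | N.IsFlow f} := by
  have hb : ∀ P : N.TPath, ∃ B : ℝ, ∀ f, N.IsFlow f → f P ≤ B := by
    intro P
    obtain ⟨⟨⟨u, v⟩, hu, hv, huv⟩, p, hp⟩ := P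
    cases p with
    | nil => exact absurd rfl huv
    | @cons _ w _ h p =>
      refine ⟨N.mult u w, fun f hf => le_trans ?_ (hf.2 u w h)⟩
      refine le_trans ?_ (Finset.single_le_sum (fun Q _ =>
        mul_nonneg (hf.1 Q) (Nat.cast_nonneg _)) (Finset.mem_univ
          (⟨⟨(u, v), hu, hv, huv⟩, ⟨SimpleGraph.Walk.cons h p, hp⟩⟩ : N.TPath)))
      refine le_mul_of_one_le_right (hf.1 _) ?_
      have : 0 < (SimpleGraph.Walk.cons h p).edges.count s(u, w) :=
        List.count_pos_iff.mpr (by simp)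
      exact_mod_cast this
  choose B hB using hb
  refine IsCompact.of_isClosed_subset (isCompact_univ_pi fun P => isCompact_Icc (a := 0) (b := B P))
    ?_ fun f hf P _ => ⟨hf.1 P, hB P f hf⟩
  have : {f : N.TPath → ℝ | N.IsFlow f} = (⋂ P, {f | 0 ≤ f P}) ∩
      ⋂ x, ⋂ y, ⋂ _ : N.graph.Adj x y,
        {f | ∑ P, f P * (P.traversals x y : ℝ) ≤ (N.mult x y : ℝ)} := by
    ext f; simp [IsFlow]
  rw [this]
  refine (isClosed_iInter fun P => isClosed_le continuous_const (continuous_apply P)).inter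
    (isClosed_iInter fun x => isClosed_iInter fun y => isClosed_iInter fun _ =>
      isClosed_le (by fun_prop) continuous_const)

theorem isGreatest_theta (N : Network V) : IsGreatest N.flowValues N.theta := by
  have himg : N.flowValues = N.reward_flow '' {f | N.IsFlow f} := rfl
  have hc : IsCompact N.flowValues := by
    rw [himg]
    refine N.isCompact_setOf_isFlow.image ?_
    unfold reward_flow
    fun_prop
  exact hc.isGreatest_sSup ⟨_, _, isFlow_zero, rfl⟩

theorem theta_le_cost {m : V → V → ℝ} (hm : N.IsDualMetric m) : N.theta ≤ N.cost m := by
  obtain ⟨f, hf, h⟩ := N.isGreatest_theta.1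
  exact h ▸ reward_flow_le_cost hm hf

/-- Linear programming duality for a packing problem with positive capacities `c`, incidence
coefficients `M` and rewards `r`: if `θ` bounds the total reward of all packings, then some
non-negative weighting of the constraints covers every reward at a total price of at most `θ`.
The weights come from separating the point `(c, θ)` from the open convex set of pairs `(u, z)` such
that some non-negative `f` has load below `u` and total reward above `z`. -/
theorem exists_packing_dual {κ E : Type*} [Fintype κ] [Fintype E] (M : κ → E → ℝ) {c : E → ℝ}
    (hc : ∀ e, 0 < c e) (r : κ → ℝ) {θ : ℝ}
    (hθ : ∀ f : κ → ℝ, (∀ P, 0 ≤ f P) → (∀ e, ∑ P, f P * M P e ≤ c e) → ∑ P, f P * r P ≤ θ) :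
    ∃ l : E → ℝ, (∀ e, 0 ≤ l e) ∧ (∀ P, r P ≤ ∑ e, l e * M P e) ∧ ∑ e, l e * c e ≤ θ := by
  let load : (κ → ℝ) → E → ℝ := fun f e => ∑ P, f P * M P e
  let rew : (κ → ℝ) → ℝ := fun f => ∑ P, f P * r P
  let C : Set ((E → ℝ) × ℝ) := {q | ∃ f : κ → ℝ, (∀ P, 0 ≤ f P) ∧ (∀ e, load f e < q.1 e) ∧
    q.2 < rew f}
  have load_add : ∀ (a b : ℝ) f g e, load (fun P => a * f P + b * g P) e =
      a * load f e + b * load g e := by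
    intro a b f g e
    simp only [load, Finset.mul_sum, ← Finset.sum_add_distrib]
    exact Finset.sum_congr rfl fun P _ => by ring
  have rew_add : ∀ (a b : ℝ) f g, rew (fun P => a * f P + b * g P) =
      a * rew f + b * rew g := by
    intro a b f g
    simp only [rew, Finset.mul_sum, ← Finset.sum_add_distrib]
    exact Finset.sum_congr rfl fun P _ => by ring
  have combo : ∀ {a b x y x' y' : ℝ}, 0 ≤ a → 0 ≤ b → a + b = 1 → x < x' → y < y' →
      a * x + b * y < a * x' + b * y' := by
    intro a b x y x' y' ha hb hab hx hy
    rcases ha.eq_or_lt with rfl | ha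
    · have : b = 1 := by linarith
      simpa [this] using hy
    · have := mul_lt_mul_of_pos_left hx ha
      have := mul_le_mul_of_nonneg_left hy.le hb
      linarith
  have hconv : Convex ℝ C := by
    rintro ⟨u, z⟩ ⟨f, hf, hfu, hfz⟩ ⟨u', z'⟩ ⟨g, hg, hgu, hgz⟩ a b ha hb hab
    refine ⟨fun P => a * f P + b * g P, fun P => ?_, fun e => ?_, ?_⟩
    · exact add_nonneg (mul_nonneg ha (hf P)) (mul_nonneg hb (hg P))
    · rw [load_add]
      exact combo ha hb hab (hfu e) (hgu e)
    · rw [rew_add]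
      exact combo ha hb hab hfz hgz
  have hopen : IsOpen C := by
    have : C = ⋃ f : κ → ℝ, ⋃ _ : ∀ P, 0 ≤ f P, (⋂ e, {q | load f e < q.1 e}) ∩
        {q | q.2 < rew f} := by
      ext q; simp [C, and_left_comm]
    rw [this]
    refine isOpen_iUnion fun f => isOpen_iUnion fun _ => IsOpen.inter ?_ ?_
    · exact isOpen_iInter_of_finite fun e => isOpen_lt continuous_const (by fun_prop)
    · exact isOpen_lt (by fun_prop) continuous_const
  have hnot : (c, θ) ∉ C := by
    rintro ⟨f, hf, hfc, hfz⟩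
    exact absurd (hθ f hf fun e => (hfc e).le) (not_le.mpr hfz)
  obtain ⟨g, hg⟩ := geometric_hahn_banach_open_point hconv hopen hnot
  set l : E → ℝ := fun e => -g (Pi.single e 1, 0) with hl
  set ρ : ℝ := g (0, 1) with hρ
  have hgeq : ∀ u z, g (u, z) = -∑ e, l e * u e + ρ * z := by
    intro u z
    have h1 : ((u, z) : (E → ℝ) × ℝ) = ∑ e, u e • ((Pi.single e 1, 0) : (E → ℝ) × ℝ) +
        z • ((0, 1) : (E → ℝ) × ℝ) := by
      refine Prod.ext ?_ ?_
      · funext e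
        simp [Prod.fst_sum, Finset.sum_apply, Pi.single_apply]
      · simp [Prod.snd_sum]
    rw [h1]
    simp only [map_add, map_sum, map_smul, smul_eq_mul, hl, hρ, neg_mul, Finset.sum_neg_distrib,
      neg_neg]
    rw [mul_comm]
    simp only [mul_comm]
  set k : ℝ := -∑ e, l e * c e + ρ * θ with hk
  -- the strict separation passes to the closure of `C`
  have hcl : ∀ (f : κ → ℝ) (u : E → ℝ) (z : ℝ), (∀ P, 0 ≤ f P) → (∀ e, load f e ≤ u e) →
      z ≤ rew f → -∑ e, l e * u e + ρ * z ≤ k := by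
    intro f u z hf hu hz
    have hε : ∀ ε > 0, -∑ e, l e * u e + ρ * z - ε * (∑ e, l e + ρ) < k := by
      intro ε hε
      have := hg (fun e => u e + ε, z - ε) ⟨f, hf, fun e => by
        have := hu e
        simp only
        linarith, by simp only; linarith⟩
      rw [hgeq, hgeq] at this
      simp only [mul_add, Finset.sum_add_distrib, ← Finset.sum_mul] at this
      linarith
    have ht : Filter.Tendsto (fun ε : ℝ => -∑ e, l e * u e + ρ * z - ε * (∑ e, l e + ρ))
        (nhdsWithin 0 (Set.Ioi 0)) (nhds (-∑ e, l e * u e + ρ * z - 0 * (∑ e, l e + ρ))) :=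
      (Continuous.tendsto (by fun_prop) 0).mono_left nhdsWithin_le_nhds
    have := le_of_tendsto ht (Filter.eventually_of_mem self_mem_nhdsWithin
      fun ε h => (hε ε h).le)
    simpa using this
  have load0 : ∀ e, load (fun _ => 0) e = 0 := fun e => by simp [load]
  have rew0 : rew (fun _ => 0) = 0 := by simp [rew]
  have arch : ∀ a b : ℝ, (∀ n : ℕ, (n : ℝ) * a ≤ b) → a ≤ 0 := by
    intro a b h
    by_contra! ha
    obtain ⟨n, hn⟩ := exists_nat_gt (b / a)
    rw [div_lt_iff₀ ha] at hn
    exact absurd (h n) (not_le.mpr hn)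
  have hl0 : ∀ e, 0 ≤ l e := by
    intro e
    have := arch (-l e) k fun n => by
      have := hcl (fun _ => 0) (Pi.single e (n : ℝ)) 0 (fun _ => le_rfl) (fun e' => by
        rw [load0, Pi.single_apply]; split_ifs <;> simp) (by rw [rew0])
      have h1 : ∑ e', l e' * (Pi.single e (n : ℝ) : E → ℝ) e' = l e * n := by
        simp [Pi.single_apply]
      rw [h1] at this
      linarith
    linarith
  have hρ0 : 0 ≤ ρ := by
    have := arch (-ρ) k fun n => by
      have := hcl (fun _ => 0) (fun _ => 0) (-n) (fun _ => le_rfl) (fun e' => by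
        rw [load0]) (by rw [rew0]; simp)
      simp only [mul_zero, Finset.sum_const_zero] at this
      linarith
    linarith
  have hk0 : 0 ≤ k := by
    simpa using hcl (fun _ => 0) (fun _ => 0) 0 (fun _ => le_rfl) (fun e' => by
        rw [load0]) (by rw [rew0])
  -- for `ρ = 0` all multipliers would vanish, against the strict separation
  have hρpos : 0 < ρ := by
    refine lt_of_le_of_ne hρ0 fun h0 => ?_
    have hsum : ∑ e, l e * c e ≤ 0 := by
      rw [hk, ← h0] at hk0; linarith
    have hz : ∀ e, l e = 0 := by
      intro e
      have h1 := Finset.single_le_sum (f := fun e => l e * c e)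
        (fun e _ => mul_nonneg (hl0 e) (hc e).le) (Finset.mem_univ e)
      have h2 : l e * c e = 0 := le_antisymm (h1.trans hsum) (mul_nonneg (hl0 e) (hc e).le)
      exact (mul_eq_zero.mp h2).resolve_right (hc e).ne'
    have := hg (fun _ => 1, -1) ⟨fun _ => 0, fun _ => le_rfl, fun e => by rw [load0]; simp, by
      rw [rew0]; simp⟩
    rw [hgeq, hgeq] at this
    simp [hz, ← h0] at this
  refine ⟨fun e => l e / ρ, fun e => div_nonneg (hl0 e) hρ0, fun P => ?_, ?_⟩
  · have := arch (ρ * r P - ∑ e, l e * M P e) k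
      fun n => by
        have h1 : ∀ e, load (Pi.single P (n : ℝ)) e = n * M P e := by
          intro e; simp [load, Pi.single_apply]
        have h2 : rew (Pi.single P (n : ℝ)) = n * r P := by
          simp [rew, Pi.single_apply]
        have := hcl (Pi.single P (n : ℝ)) _ _ (fun Q => by
          rw [Pi.single_apply]; split_ifs <;> simp) (fun e => (h1 e).le) h2.ge
        have h3 : ∑ e, l e * (n * M P e) =
            n * ∑ e, l e * M P e := by
          rw [Finset.mul_sum]; exact Finset.sum_congr rfl fun e _ => by ring
        rw [h3] at this
        linarith
    have h4 : ∑ e, l e / ρ * M P e =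
        (∑ e, l e * M P e) / ρ := by
      rw [Finset.sum_div]; exact Finset.sum_congr rfl fun e _ => by ring
    rw [h4, le_div_iff₀ hρpos]
    linarith
  · have h4 : ∑ e, l e / ρ * c e = (∑ e, l e * c e) / ρ := by
      rw [Finset.sum_div]; exact Finset.sum_congr rfl fun e _ => by ring
    rw [h4, div_le_iff₀ hρpos]
    linarith

theorem walkLength_nonneg {W : Type*} {G : SimpleGraph W} {L : W → W → ℝ}
    (hL : ∀ x y, 0 ≤ L x y) {u v : W}
    (p : G.Walk u v) : 0 ≤ walkLength L p :=
  List.sum_nonneg (by simp only [List.mem_map]; rintro _ ⟨d, _, rfl⟩; exact hL _ _)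

theorem walkLength_bypass_le {W : Type*} {G : SimpleGraph W} {L : W → W → ℝ}
    (hL : ∀ x y, 0 ≤ L x y) {u v : W}
    (p : G.Walk u v) : walkLength L p.bypass ≤ walkLength L p := by
  have hnd : p.bypass.darts.Nodup :=
    SimpleGraph.Walk.darts_nodup_of_support_nodup p.bypass_isPath.support_nodup
  obtain ⟨l, hl, hsub⟩ := List.subperm_of_subset hnd p.darts_bypass_subset_darts
  unfold walkLength
  rw [← (hl.map _).sum_eq]
  refine List.Sublist.sum_le_sum (hsub.map _) ?_
  simp only [List.mem_map]; rintro _ ⟨d, _, rfl⟩; exact hL _ _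

/-- Strong duality: some feasible pseudo-metric costs at most `θ`. It is the shortest-walk distance
for the multipliers of the capacity constraints, cut off at `1` to stay finite between different
components. -/
theorem exists_isDualMetric_cost_le (N : Network V) :
    ∃ m, N.IsDualMetric m ∧ N.cost m ≤ N.theta := by
  obtain ⟨l, hl0, hlP, hlc⟩ := exists_packing_dual
    (fun (P : N.TPath) (e : {e : V × V // N.graph.Adj e.1 e.2}) => (P.traversals e.1.1 e.1.2 : ℝ))
    (c := fun e => (N.mult e.1.1 e.1.2 : ℝ)) (fun e => Nat.cast_pos.mpr e.2)
    (fun P => N.reward P.fst P.snd) (θ := N.theta) fun f hf hfc =>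
      N.isGreatest_theta.2 ⟨f, ⟨hf, fun x y hxy => hfc ⟨(x, y), hxy⟩⟩, rfl⟩
  let l' : V → V → ℝ := fun x y => if h : N.graph.Adj x y then l ⟨(x, y), h⟩ else 0
  let L : V → V → ℝ := fun x y => l' x y + l' y x
  have hl'0 : ∀ x y, 0 ≤ l' x y := fun x y => by
    simp only [l']; split_ifs; exacts [hl0 _, le_rfl]
  have hL0 : ∀ x y, 0 ≤ L x y := fun x y => add_nonneg (hl'0 _ _) (hl'0 _ _)
  have hLs : ∀ x y, L x y = L y x := fun x y => add_comm _ _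
  have hsum : ∀ w : V → V → ℝ, (∀ x y, w x y = w y x) →
      1 / 2 * ∑ x, ∑ y, w x y * L x y = ∑ e : {e : V × V // N.graph.Adj e.1 e.2},
        l e * w e.1.1 e.1.2 := by
    intro w hw
    have h1 : ∑ x, ∑ y, w x y * l' y x = ∑ x, ∑ y, w x y * l' x y := by
      rw [Finset.sum_comm]
      exact Finset.sum_congr rfl fun y _ => Finset.sum_congr rfl fun x _ => by rw [hw]
    have h2 : ∑ x, ∑ y, w x y * l' x y = ∑ e : {e : V × V // N.graph.Adj e.1 e.2},
        l e * w e.1.1 e.1.2 := by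
      rw [← Finset.sum_product', Finset.univ_product_univ]
      rw [← Finset.sum_filter_add_sum_filter_not Finset.univ
        (fun e : V × V => N.graph.Adj e.1 e.2), Finset.sum_eq_zero (s := Finset.univ.filter
          fun e : V × V => ¬ N.graph.Adj e.1 e.2), add_zero, ← Finset.sum_subtype_eq_sum_filter]
      · refine Finset.sum_congr (by ext; simp) fun e _ => ?_
        simp only [l', dif_pos e.2]
        exact mul_comm _ _
      · intro e he
        simp only [l', dif_neg (Finset.mem_filter.mp he).2, mul_zero]
    simp only [L, mul_add, Finset.sum_add_distrib, h1, h2]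
    ring
  let m : V → V → ℝ := fun x y =>
    ⨅ w : Option (N.graph.Walk x y), w.elim 1 (walkLength L)
  have hbdd : ∀ x y, BddBelow (Set.range fun w : Option (N.graph.Walk x y) =>
      w.elim 1 (walkLength L)) := by
    intro x y
    refine ⟨0, ?_⟩
    rintro _ ⟨w | w, rfl⟩
    · exact zero_le_one
    · exact walkLength_nonneg hL0 w
  have hm1 : ∀ x y, m x y ≤ 1 := fun x y => ciInf_le (hbdd x y) none
  have hmw : ∀ {x y} (w : N.graph.Walk x y), m x y ≤ walkLength L w :=
    fun {x y} w => ciInf_le (hbdd x y) (some w)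
  have hlm : ∀ {x y} {a : ℝ}, a ≤ 1 → (∀ w : N.graph.Walk x y, a ≤ walkLength L w) → a ≤ m x y :=
    fun h1 h2 => le_ciInf fun w => by cases w; exacts [h1, h2 _]
  have hm0 : ∀ x y, 0 ≤ m x y := fun x y => hlm zero_le_one (walkLength_nonneg hL0)
  have hrev : ∀ {x y} (w : N.graph.Walk x y), walkLength L w.reverse = walkLength L w := by
    intro x y w
    simp only [walkLength, SimpleGraph.Walk.darts_reverse, List.map_reverse, List.map_map,
      List.sum_reverse]
    congr 1
    exact List.map_congr_left fun d _ => by simp [hLs d.snd d.fst]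
  have hms : ∀ x y, m x y ≤ m y x := fun x y => hlm (hm1 _ _) fun w => by
    rw [← hrev]; exact hmw _
  refine ⟨m, ⟨fun x => ?_, fun x y => (hms x y).antisymm (hms y x), fun x y z => ?_,
    fun s hs t ht hst => ?_⟩, ?_⟩
  · refine le_antisymm ?_ (hm0 _ _)
    simpa [walkLength] using hmw (SimpleGraph.Walk.nil : N.graph.Walk x x)
  · refine le_ciInf_add_ciInf fun w w' => ?_
    rcases w with _ | w <;> rcases w' with _ | w'
    · have := hm1 x z; simp only [Option.elim]; linarith
    · have := hm1 x z; have := walkLength_nonneg hL0 w'; simp only [Option.elim]; linarith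
    · have := hm1 x z; have := walkLength_nonneg hL0 w; simp only [Option.elim]; linarith
    · refine (hmw (w.append w')).trans_eq ?_
      simp [walkLength, SimpleGraph.Walk.darts_append]
  · refine hlm (reward_le_one s t) fun w => ?_
    refine le_trans ?_ (walkLength_bypass_le hL0 w)
    have := hlP ⟨⟨(s, t), hs, ht, hst⟩, ⟨w.bypass, w.bypass_isPath⟩⟩
    refine le_trans this ?_
    rw [← sum_count_mul_eq_walkLength hLs, hsum _ (fun x y => by rw [Sym2.eq_swap])]
    exact le_rfl
  · refine le_trans (cost_mono (m' := L) fun x y hxy => ?_) ?_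
    · simpa [walkLength] using hmw (SimpleGraph.Walk.cons (show N.graph.Adj x y from hxy) .nil)
    · unfold cost
      rw [hsum (fun x y => (N.mult x y : ℝ)) (fun x y => by rw [N.mult_symm])]
      exact hlc

/-! ### Cuts -/

/-- The pseudo-metric of the cut between `X` and its complement. -/
def cutMetric {W : Type*} (X : Finset W) (x y : W) : ℝ := if (x ∈ X ↔ y ∈ X) then 0 else 1

theorem cost_add (m m' : V → V → ℝ) :
    N.cost (fun x y => m x y + m' x y) = N.cost m + N.cost m' := by
  simp only [cost, mul_add, Finset.sum_add_distrib]

theorem cost_const_mul (c : ℝ) (m : V → V → ℝ) :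
    N.cost (fun x y => c * m x y) = c * N.cost m := by
  simp only [cost, Finset.mul_sum]
  exact Finset.sum_congr rfl fun x _ => Finset.sum_congr rfl fun y _ => by ring

theorem cost_sum {ι : Type*} (s : Finset ι) (m : ι → V → V → ℝ) :
    N.cost (fun x y => ∑ i ∈ s, m i x y) = ∑ i ∈ s, N.cost (m i) := by
  simp only [cost, Finset.mul_sum]
  rw [Finset.sum_comm (s := s)]
  refine Finset.sum_congr rfl fun x _ => ?_
  rw [Finset.sum_comm (s := s)]

theorem cost_cutMetric (N : Network V) (X : Finset V) : N.cost (cutMetric X) = N.d X := by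
  have h : ∀ x y, (N.mult x y : ℝ) * cutMetric X x y =
      (if x ∈ X then if y ∈ Xᶜ then (N.mult x y : ℝ) else 0 else 0) +
        (if y ∈ X then if x ∈ Xᶜ then (N.mult y x : ℝ) else 0 else 0) := by
    intro x y
    by_cases hx : x ∈ X <;> by_cases hy : y ∈ X <;> simp [cutMetric, hx, hy, N.mult_symm]
  have h2 : ∑ x, ∑ y, (if x ∈ X then if y ∈ Xᶜ then (N.mult x y : ℝ) else 0 else 0) = N.d X := by
    have : ∀ x, ∑ y, (if x ∈ X then if y ∈ Xᶜ then (N.mult x y : ℝ) else 0 else 0) =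
        if x ∈ X then ∑ y ∈ Xᶜ, (N.mult x y : ℝ) else 0 := by
      intro x
      split_ifs
      · rw [← Finset.sum_filter]; congr 1; ext; simp
      · simp
    simp only [this, d]
    rw [← Finset.sum_filter]
    push_cast
    congr 1; ext; simp
  unfold cost
  simp only [h, Finset.sum_add_distrib, h2]
  rw [Finset.sum_comm, h2]
  ring

theorem d_sdiff_add_d_sdiff_le (N : Network V) (X Y : Finset V) :
    N.d (X \ Y) + N.d (Y \ X) ≤ N.d X + N.d Y := by
  have : N.cost (fun x y => cutMetric (X \ Y) x y + cutMetric (Y \ X) x y) ≤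
      N.cost (fun x y => cutMetric X x y + cutMetric Y x y) := by
    refine cost_mono fun x y _ => ?_
    by_cases h1 : x ∈ X <;> by_cases h2 : y ∈ X <;> by_cases h3 : x ∈ Y <;> by_cases h4 : y ∈ Y <;>
      simp [cutMetric, h1, h2, h3, h4]
  rw [cost_add, cost_add] at this
  simp only [cost_cutMetric] at this
  exact_mod_cast this

theorem lam_le {X A : Finset V} (h : X ∩ N.T = A) : N.lam A ≤ N.d X :=
  Nat.sInf_le ⟨X, h, rfl⟩

theorem exists_d_eq_lam {A : Finset V} (hA : A ⊆ N.T) :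
    ∃ X : Finset V, X ∩ N.T = A ∧ N.d X = N.lam A :=
  Nat.sInf_mem (s := {n | ∃ X : Finset V, X ∩ N.T = A ∧ N.d X = n})
    ⟨_, A, Finset.inter_eq_left.mpr hA, rfl⟩

/-- A potential of height `k` at the terminal `t`, vanishing at the other terminals, varies by at
least `k λ(t)`: each of its `k` upper level sets is a cut separating `t` from the other
terminals. -/
theorem mul_lam_le_cost {t : V} (ht : t ∈ N.T) (e : V → ℕ)
    (he : ∀ s ∈ N.T, s ≠ t → e s = 0) :
    (e t : ℝ) * N.lam {t} ≤ N.cost fun x y => |(e x : ℝ) - e y| := by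
  have h1 : ∀ j ∈ Finset.range (e t), (N.lam {t} : ℝ) ≤
      N.cost (cutMetric (Finset.univ.filter fun x => j < e x)) := by
    intro j hj
    rw [cost_cutMetric]
    have : (Finset.univ.filter fun x => j < e x) ∩ N.T = {t} := by
      ext x
      simp only [Finset.mem_inter, Finset.mem_filter, Finset.mem_univ, true_and,
        Finset.mem_singleton]
      constructor
      · rintro ⟨hx, hxT⟩
        by_contra hne
        rw [he x hxT hne] at hx
        omega
      · rintro rfl
        exact ⟨Finset.mem_range.mp hj, ht⟩
    exact_mod_cast lam_le this
  have h2 := Finset.sum_le_sum h1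
  rw [← cost_sum, Finset.sum_const, Finset.card_range, nsmul_eq_mul] at h2
  refine h2.trans (cost_mono fun x y _ => ?_)
  have key : ∀ a b : ℕ, a ≤ b → ∀ n : ℕ,
      (∑ j ∈ Finset.range n, if (j < a ↔ j < b) then (0 : ℝ) else 1) ≤ (b : ℝ) - a := by
    intro a b hab n
    have : ∀ j ∈ Finset.range n, (if (j < a ↔ j < b) then (0 : ℝ) else 1) =
        if j ∈ Finset.Ico a b then 1 else 0 := by
      intro j _
      simp only [Finset.mem_Ico]
      split_ifs <;> first | rfl | omega
    rw [Finset.sum_congr rfl this, ← Finset.sum_filter, Finset.sum_const, nsmul_eq_mul, mul_one]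
    have hc := Finset.card_le_card (show (Finset.range n).filter (fun j => j ∈ Finset.Ico a b) ⊆
      Finset.Ico a b from fun j hj => (Finset.mem_filter.mp hj).2)
    rw [Nat.card_Ico] at hc
    rw [← Nat.cast_sub hab]
    exact_mod_cast hc
  simp only [cutMetric, Finset.mem_filter, Finset.mem_univ, true_and]
  rcases le_total (e x) (e y) with h | h
  · rw [abs_sub_comm]
    exact (key _ _ h _).trans (le_abs_self _)
  · simp only [iff_comm (a := _ < e x)]
    exact (key _ _ h _).trans (le_abs_self _)

/-! ### Anticliques, zero pairs and the reward function -/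

theorem subset_of_mem_anticliques {A : Finset V} (hA : A ∈ N.anticliques) : A ⊆ N.T :=
  (Finset.mem_filter.mp hA).2.prop.1

theorem not_adj_of_mem_anticliques {A : Finset V} (hA : A ∈ N.anticliques) {u v : V}
    (hu : u ∈ A) (hv : v ∈ A) : ¬ N.S.Adj u v :=
  (Finset.mem_filter.mp hA).2.prop.2 u hu v hv

theorem mem_anticliques_iff {A : Finset V} : A ∈ N.anticliques ↔
    (A ⊆ N.T ∧ ∀ u ∈ A, ∀ v ∈ A, ¬ N.S.Adj u v) ∧
      ∀ u ∈ N.T, (∀ v ∈ A, ¬ N.S.Adj u v) → u ∈ A := by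
  constructor
  · intro hA
    have h := (Finset.mem_filter.mp hA).2
    refine ⟨h.prop, fun u hu huA => ?_⟩
    refine h.le_of_ge (y := insert u A) ⟨Finset.insert_subset hu h.prop.1, ?_⟩
      (Finset.subset_insert _ _) (Finset.mem_insert_self _ _)
    intro v hv w hw
    rcases Finset.mem_insert.mp hv with hv | hv <;> rcases Finset.mem_insert.mp hw with hw | hw
    · rw [hv, hw]; exact N.S.loopless.irrefl _
    · rw [hv]; exact huA w hw
    · rw [hw]; exact fun h => huA v hv h.symm
    · exact h.prop.2 v hv w hw
  · rintro ⟨h1, h2⟩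
    refine Finset.mem_filter.mpr ⟨Finset.mem_univ _, h1, fun B hB hAB u hu => ?_⟩
    exact h2 u (hB.1 hu) fun v hv => hB.2 u hu v (hAB hv)

theorem exists_anticlique_superset {B : Finset V} (hB : B ⊆ N.T)
    (hst : ∀ u ∈ B, ∀ v ∈ B, ¬ N.S.Adj u v) : ∃ A ∈ N.anticliques, B ⊆ A := by
  obtain ⟨A, hBA, hA⟩ := Set.Finite.exists_le_maximal
    (s := {A : Finset V | A ⊆ N.T ∧ ∀ u ∈ A, ∀ v ∈ A, ¬ N.S.Adj u v}) (Set.toFinite _) (a := B)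
    ⟨hB, hst⟩
  exact ⟨A, Finset.mem_filter.mpr ⟨Finset.mem_univ _, hA⟩, hBA⟩

theorem exists_anticlique_mem {t : V} (ht : t ∈ N.T) : ∃ A ∈ N.anticliques, t ∈ A := by
  obtain ⟨A, hA, h⟩ := exists_anticlique_superset (N := N) (B := {t}) (by simpa using ht)
    (by simp)
  exact ⟨A, hA, h (by simp)⟩

theorem coverNumber_eq_zero_iff {u v : V} :
    N.coverNumber u v = 0 ↔ ∀ A ∈ N.anticliques, u ∈ A → v ∉ A := by
  simp [coverNumber, Finset.filter_eq_empty_iff]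

theorem coverNumber_comm (u v : V) : N.coverNumber u v = N.coverNumber v u := by
  simp only [coverNumber, and_comm]

theorem reward_comm (u v : V) : N.reward u v = N.reward v u := by
  simp only [reward, coverNumber_comm u v, N.S.adj_comm u v]

theorem adj_iff_coverNumber_eq_zero {u v : V} (hu : u ∈ N.T) (hv : v ∈ N.T) :
    N.S.Adj u v ↔ N.coverNumber u v = 0 := by
  rw [coverNumber_eq_zero_iff]
  constructor
  · exact fun h A hA hu' hv' => not_adj_of_mem_anticliques hA hu' hv' h
  · intro h
    by_contra hadj
    obtain ⟨A, hA, hsub⟩ := exists_anticlique_superset (N := N) (B := {u, v})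
      (by simp [Finset.insert_subset_iff, hu, hv])
      (by simp [hadj, N.S.adj_comm v u])
    exact h A hA (hsub (by simp)) (hsub (by simp))

theorem reward_eq_coverNumber {u v : V} (hu : u ∈ N.T) (hv : v ∈ N.T) :
    N.reward u v = if N.coverNumber u v = 0 then 1 else if N.coverNumber u v = 1 then 1 / 2
      else 0 := by
  simp only [reward, adj_iff_coverNumber_eq_zero hu hv]

theorem IsZeroPair.symm {s t : V} (h : N.IsZeroPair s t) : N.IsZeroPair t s :=
  ⟨h.1.symm, coverNumber_comm s t ▸ h.2⟩

/-- Two anticliques covering a pair. -/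
theorem exists_two_anticliques {s t : V} (h : 2 ≤ N.coverNumber s t) :
    ∃ A ∈ N.anticliques, ∃ B ∈ N.anticliques, A ≠ B ∧ (s ∈ A ∧ t ∈ A) ∧ s ∈ B ∧ t ∈ B := by
  obtain ⟨A, hA, B, hB, hAB⟩ := Finset.one_lt_card.mp (show 1 < _ from h)
  rw [Finset.mem_filter] at hA hB
  exact ⟨A, hA.1, B, hB.1, hAB, hA.2, hB.2⟩

/-- In a K-clutter the members of a zero pair lie in the same anticliques. -/
theorem IsZeroPair.mem_of_mem (hK : N.IsKClutter) {s t : V} (h : N.IsZeroPair s t)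
    {C : Finset V} (hC : C ∈ N.anticliques) (hs : s ∈ C) : t ∈ C := by
  obtain ⟨A, hA, B, hB, hAB, hA', hB'⟩ := exists_two_anticliques h.2
  by_cases hAC : A = C
  · exact hAC ▸ hA'.2
  by_cases hBC : B = C
  · exact hBC ▸ hB'.2
  have := (hK A hA B hB C hC hAB hAC hBC ⟨s, by simp [hA'.1, hB'.1]⟩ ⟨s, by simp [hA'.1, hs]⟩
    ⟨s, by simp [hB'.1, hs]⟩).1
  have ht : t ∈ A ∩ C := this ▸ Finset.mem_inter.mpr ⟨hA'.2, hB'.2⟩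
  exact (Finset.mem_inter.mp ht).2

theorem IsZeroPair.mem_iff (hK : N.IsKClutter) {s t : V} (h : N.IsZeroPair s t)
    {C : Finset V} (hC : C ∈ N.anticliques) : s ∈ C ↔ t ∈ C :=
  ⟨h.mem_of_mem hK hC, h.symm.mem_of_mem hK hC⟩

theorem IsZeroPair.mem_left {s t : V} (h : N.IsZeroPair s t) : s ∈ N.T := by
  obtain ⟨A, hA, _, _, _, h', _⟩ := exists_two_anticliques h.2
  exact subset_of_mem_anticliques hA h'.1

theorem IsZeroPair.coverNumber_eq (hK : N.IsKClutter) {s t : V} (h : N.IsZeroPair s t) (u : V) :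
    N.coverNumber s u = N.coverNumber t u := by
  unfold coverNumber
  congr 1
  exact Finset.filter_congr fun A hA => by rw [h.mem_iff hK hA]

theorem IsZeroPair.trans (hK : N.IsKClutter) {s t u : V} (h : N.IsZeroPair s t)
    (h' : N.IsZeroPair t u) (hne : s ≠ u) : N.IsZeroPair s u :=
  ⟨hne, by rw [h.coverNumber_eq hK]; exact h'.2⟩

/-- The pseudo-metric on the terminals given by the reward function. -/
def rewardMetric (N : Network V) (u v : V) : ℝ := if u = v then 0 else N.reward u v

theorem rewardMetric_comm (u v : V) : N.rewardMetric u v = N.rewardMetric v u := by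
  simp only [rewardMetric, reward_comm u v, eq_comm]

theorem rewardMetric_le {m : V → V → ℝ} (hm : N.IsDualMetric m) {s t : V} (hs : s ∈ N.T)
    (ht : t ∈ N.T) : N.rewardMetric s t ≤ m s t := by
  unfold rewardMetric
  split_ifs with h
  · exact hm.nonneg _ _
  · exact hm.reward_le s hs t ht h

theorem IsZeroPair.rewardMetric_eq_zero {s t : V} (h : N.IsZeroPair s t) (ht : t ∈ N.T) :
    N.rewardMetric s t = 0 := by
  have h2 := h.2
  rw [rewardMetric, if_neg h.1, reward_eq_coverNumber h.mem_left ht, if_neg (by omega),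
    if_neg (by omega)]

theorem IsZeroPair.rewardMetric_eq (hK : N.IsKClutter) {s t : V} (h : N.IsZeroPair s t) {u : V}
    (hu : u ∈ N.T) : N.rewardMetric s u = N.rewardMetric t u := by
  have hs := h.mem_left
  have ht := h.symm.mem_left
  by_cases hsu : s = u
  · subst hsu
    rw [h.symm.rewardMetric_eq_zero hs, rewardMetric, if_pos rfl]
  by_cases htu : t = u
  · subst htu
    rw [h.rewardMetric_eq_zero ht, rewardMetric, if_pos rfl]
  rw [rewardMetric, rewardMetric, if_neg hsu, if_neg htu, reward_eq_coverNumber hs hu,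
    reward_eq_coverNumber ht hu, h.coverNumber_eq hK]

/-- The reward function takes the values `0`, `1 / 2` and `1` only, and zero pairs have equal
rewards to all terminals. -/
theorem rewardMetric_triangle (hK : N.IsKClutter) {s t u : V} (hs : s ∈ N.T) (ht : t ∈ N.T)
    (hu : u ∈ N.T) : N.rewardMetric s u ≤ N.rewardMetric s t + N.rewardMetric t u := by
  have h0 : ∀ a b, 0 ≤ N.rewardMetric a b := fun a b => by
    unfold rewardMetric; split_ifs; exacts [le_rfl, reward_nonneg _ _]
  have h1 : N.rewardMetric s u ≤ 1 := by
    unfold rewardMetric; split_ifs; exacts [zero_le_one, reward_le_one _ _]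
  have half : ∀ {a b}, a ∈ N.T → b ∈ N.T →
      a = b ∨ N.IsZeroPair a b ∨ 1 / 2 ≤ N.rewardMetric a b := by
    intro a b ha hb
    by_cases hab : a = b
    · exact Or.inl hab
    by_cases hc : 2 ≤ N.coverNumber a b
    · exact Or.inr (Or.inl ⟨hab, hc⟩)
    · refine Or.inr (Or.inr ?_)
      rw [rewardMetric, if_neg hab, reward_eq_coverNumber ha hb]
      split_ifs <;> first | omega | norm_num
  rcases half hs ht with rfl | h | h
  · linarith [h0 s s]
  · rw [h.rewardMetric_eq hK hu]
    linarith [h0 s t]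
  rcases half ht hu with rfl | h' | h'
  · linarith [h0 t t]
  · rw [rewardMetric_comm s t, h'.rewardMetric_eq hK hs, rewardMetric_comm u s]
    linarith [h0 t u]
  · linarith

/-! ### Contraction along an expansion -/

/-- There are no zero pairs. -/
def NoZeroPairs (N : Network V) : Prop := ∀ s t, ¬ N.IsZeroPair s t

/-- The value of the min-max formula for the family of all terminals, taken as singletons. -/
def cutValue (N : Network V) : ℝ :=
  1 / 2 * ∑ t ∈ N.T, (N.d {t} : ℝ) - 1 / 2 * ∑ A ∈ N.anticliques, N.beta A

namespace Expansion

variable (𝒳 : N.Expansion)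

theorem toNode_eq_iff {u v : V} :
    𝒳.toNode u = 𝒳.toNode v ↔ u = v ∨ ∃ X ∈ 𝒳.members, u ∈ X ∧ v ∈ X :=
  Quotient.eq (r := 𝒳.setoid)

theorem toNode_surjective (a : 𝒳.Node) : ∃ v, 𝒳.toNode v = a := Quotient.exists_rep a

theorem mem_network_T {a : 𝒳.Node} : a ∈ 𝒳.network.T ↔ ∃ t ∈ N.T, 𝒳.toNode t = a :=
  Finset.mem_image

theorem toNode_mem_T {t : V} (ht : t ∈ N.T) : 𝒳.toNode t ∈ 𝒳.network.T :=
  Finset.mem_image_of_mem _ ht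

theorem eq_or_isZeroPair {s t : V} (hs : s ∈ N.T) (ht : t ∈ N.T) (h : 𝒳.toNode s = 𝒳.toNode t) :
    s = t ∨ N.IsZeroPair s t := by
  by_cases hst : s = t
  · exact Or.inl hst
  · obtain h | ⟨X, hX, hsX, htX⟩ := 𝒳.toNode_eq_iff.mp h
    · exact Or.inl h
    · exact Or.inr (𝒳.equi X hX s (Finset.mem_inter.mpr ⟨hsX, hs⟩) t
        (Finset.mem_inter.mpr ⟨htX, ht⟩) hst)

theorem mem_iff_of_toNode_eq (hK : N.IsKClutter) {s t : V} (hs : s ∈ N.T) (ht : t ∈ N.T)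
    (h : 𝒳.toNode s = 𝒳.toNode t) {A : Finset V} (hA : A ∈ N.anticliques) : s ∈ A ↔ t ∈ A := by
  rcases 𝒳.eq_or_isZeroPair hs ht h with rfl | h
  · exact Iff.rfl
  · exact h.mem_iff hK hA

theorem network_adj_iff (hK : N.IsKClutter) {s t : V} (hs : s ∈ N.T) (ht : t ∈ N.T) :
    𝒳.network.S.Adj (𝒳.toNode s) (𝒳.toNode t) ↔ N.S.Adj s t := by
  constructor
  · exact fun h => h.2.2.2 s hs t ht rfl rfl
  · intro h
    have hc := (adj_iff_coverNumber_eq_zero hs ht).mp h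
    rw [coverNumber_eq_zero_iff] at hc
    refine ⟨𝒳.toNode_mem_T hs, 𝒳.toNode_mem_T ht, fun heq => ?_, fun s' hs' t' ht' h1 h2 => ?_⟩
    · obtain ⟨A, hA, hsA⟩ := exists_anticlique_mem hs
      exact hc A hA hsA ((𝒳.mem_iff_of_toNode_eq hK hs ht heq hA).mp hsA)
    · rw [adj_iff_coverNumber_eq_zero hs' ht', coverNumber_eq_zero_iff]
      intro A hA hsA htA
      exact hc A hA ((𝒳.mem_iff_of_toNode_eq hK hs' hs h1 hA).mp hsA)
        ((𝒳.mem_iff_of_toNode_eq hK ht' ht h2 hA).mp htA)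

theorem toNode_mem_image_iff (hK : N.IsKClutter) {A : Finset V} (hA : A ∈ N.anticliques) {t : V}
    (ht : t ∈ N.T) : 𝒳.toNode t ∈ A.image 𝒳.toNode ↔ t ∈ A := by
  constructor
  · intro h
    obtain ⟨s, hs, hst⟩ := Finset.mem_image.mp h
    exact (𝒳.mem_iff_of_toNode_eq hK (subset_of_mem_anticliques hA hs) ht hst hA).mp hs
  · exact Finset.mem_image_of_mem _

/-- Contraction carries the anticliques to the anticliques of the contracted network. -/
theorem network_anticliques (hK : N.IsKClutter) :
    𝒳.network.anticliques = N.anticliques.image fun A => A.image 𝒳.toNode := by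
  ext B
  rw [Finset.mem_image]
  constructor
  · intro hB
    have hB' := mem_anticliques_iff.mp hB
    refine ⟨N.T.filter fun t => 𝒳.toNode t ∈ B, ?_, ?_⟩
    · refine mem_anticliques_iff.mpr ⟨⟨Finset.filter_subset _ _, fun u hu v hv => ?_⟩,
        fun u hu h => ?_⟩
      · rw [Finset.mem_filter] at hu hv
        rw [← 𝒳.network_adj_iff hK hu.1 hv.1]
        exact hB'.1.2 _ hu.2 _ hv.2
      · refine Finset.mem_filter.mpr ⟨hu, hB'.2 _ (𝒳.toNode_mem_T hu) fun b hb => ?_⟩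
        obtain ⟨v, hv, rfl⟩ := 𝒳.mem_network_T.mp (hB'.1.1 hb)
        rw [𝒳.network_adj_iff hK hu hv]
        exact h v (Finset.mem_filter.mpr ⟨hv, hb⟩)
    · ext b
      simp only [Finset.mem_image, Finset.mem_filter]
      constructor
      · rintro ⟨t, ⟨_, h⟩, rfl⟩
        exact h
      · intro hb
        obtain ⟨t, ht, rfl⟩ := 𝒳.mem_network_T.mp (hB'.1.1 hb)
        exact ⟨t, ⟨ht, hb⟩, rfl⟩
  · rintro ⟨A, hA, rfl⟩
    have hA' := mem_anticliques_iff.mp hA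
    refine mem_anticliques_iff.mpr ⟨⟨Finset.image_subset_image hA'.1.1, fun a ha b hb => ?_⟩,
      fun a ha h => ?_⟩
    · obtain ⟨u, hu, rfl⟩ := Finset.mem_image.mp ha
      obtain ⟨v, hv, rfl⟩ := Finset.mem_image.mp hb
      rw [𝒳.network_adj_iff hK (hA'.1.1 hu) (hA'.1.1 hv)]
      exact hA'.1.2 u hu v hv
    · obtain ⟨u, hu, rfl⟩ := 𝒳.mem_network_T.mp ha
      refine Finset.mem_image_of_mem _ (hA'.2 u hu fun v hv => ?_)
      rw [← 𝒳.network_adj_iff hK hu (hA'.1.1 hv)]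
      exact h _ (Finset.mem_image_of_mem _ hv)

theorem image_toNode_injOn (hK : N.IsKClutter) :
    Set.InjOn (fun A : Finset V => A.image 𝒳.toNode) (N.anticliques : Set (Finset V)) := by
  intro A hA B hB h
  have h : A.image 𝒳.toNode = B.image 𝒳.toNode := h
  ext t
  by_cases ht : t ∈ N.T
  · rw [← 𝒳.toNode_mem_image_iff hK hA ht, h, 𝒳.toNode_mem_image_iff hK hB ht]
  · exact iff_of_false (fun h => ht (subset_of_mem_anticliques hA h))
      fun h => ht (subset_of_mem_anticliques hB h)

theorem network_coverNumber (hK : N.IsKClutter) {s t : V} (hs : s ∈ N.T) (ht : t ∈ N.T) :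
    𝒳.network.coverNumber (𝒳.toNode s) (𝒳.toNode t) = N.coverNumber s t := by
  unfold coverNumber
  rw [𝒳.network_anticliques hK, Finset.filter_image, Finset.card_image_of_injOn]
  · congr 1
    exact Finset.filter_congr fun A hA => by
      rw [𝒳.toNode_mem_image_iff hK hA hs, 𝒳.toNode_mem_image_iff hK hA ht]
  · exact (𝒳.image_toNode_injOn hK).mono fun A hA => (Finset.mem_filter.mp hA).1

theorem network_reward (hK : N.IsKClutter) {s t : V} (hs : s ∈ N.T) (ht : t ∈ N.T) :
    𝒳.network.reward (𝒳.toNode s) (𝒳.toNode t) = N.reward s t := by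
  rw [reward_eq_coverNumber hs ht, reward_eq_coverNumber (𝒳.toNode_mem_T hs) (𝒳.toNode_mem_T ht),
    𝒳.network_coverNumber hK hs ht]

theorem image_inter_image (hK : N.IsKClutter) {A B : Finset V} (hA : A ∈ N.anticliques)
    (hB : B ∈ N.anticliques) :
    A.image 𝒳.toNode ∩ B.image 𝒳.toNode = (A ∩ B).image 𝒳.toNode := by
  ext a
  simp only [Finset.mem_inter, Finset.mem_image]
  constructor
  · rintro ⟨⟨u, hu, rfl⟩, hB'⟩
    refine ⟨u, ⟨hu, ?_⟩, rfl⟩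
    exact (𝒳.toNode_mem_image_iff hK hB (subset_of_mem_anticliques hA hu)).mp
      (Finset.mem_image.mpr hB')
  · rintro ⟨u, ⟨hu, hu'⟩, rfl⟩
    exact ⟨⟨u, hu, rfl⟩, u, hu', rfl⟩

theorem network_isKClutter (hK : N.IsKClutter) : 𝒳.network.IsKClutter := by
  intro A' hA B' hB C' hC hAB hAC hBC h1 h2 h3
  rw [𝒳.network_anticliques hK, Finset.mem_image] at hA hB hC
  obtain ⟨A, hA, rfl⟩ := hA
  obtain ⟨B, hB, rfl⟩ := hB
  obtain ⟨C, hC, rfl⟩ := hC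
  rw [𝒳.image_inter_image hK hA hB] at h1 ⊢
  rw [𝒳.image_inter_image hK hA hC] at h2 ⊢
  rw [𝒳.image_inter_image hK hB hC] at h3 ⊢
  obtain ⟨e1, e2⟩ := hK A hA B hB C hC (fun h => hAB (h ▸ rfl)) (fun h => hAC (h ▸ rfl))
    (fun h => hBC (h ▸ rfl)) h1.of_image h2.of_image h3.of_image
  exact ⟨by rw [e1], by rw [e2]⟩

theorem network_noZeroPairs (hK : N.IsKClutter) (h𝒳 : 𝒳.IsReduced) :
    𝒳.network.NoZeroPairs := by
  intro a b hab
  obtain ⟨s, hs, rfl⟩ := 𝒳.mem_network_T.mp hab.mem_left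
  obtain ⟨t, ht, rfl⟩ := 𝒳.mem_network_T.mp hab.symm.mem_left
  have hst : N.IsZeroPair s t := ⟨fun h => hab.1 (h ▸ rfl), by
    have := hab.2
    rwa [𝒳.network_coverNumber hK hs ht] at this⟩
  exact hab.1 (𝒳.toNode_eq_iff.mpr (Or.inr (h𝒳 s hs t ht hst)))

/-- Costs in the contracted network are costs of the pulled back length functions. -/
theorem network_cost {m : 𝒳.Node → 𝒳.Node → ℝ} (hm : ∀ a, m a a = 0) :
    𝒳.network.cost m = N.cost fun u v => m (𝒳.toNode u) (𝒳.toNode v) := by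
  have h1 : ∀ a b, (𝒳.network.mult a b : ℝ) * m a b =
      ∑ u ∈ Finset.univ.filter (fun u => 𝒳.toNode u = a),
        ∑ v ∈ Finset.univ.filter (fun v => 𝒳.toNode v = b),
          (N.mult u v : ℝ) * m (𝒳.toNode u) (𝒳.toNode v) := by
    intro a b
    have h2 : ∀ u ∈ Finset.univ.filter (fun u => 𝒳.toNode u = a),
        ∑ v ∈ Finset.univ.filter (fun v => 𝒳.toNode v = b),
          (N.mult u v : ℝ) * m (𝒳.toNode u) (𝒳.toNode v) =
        (∑ v ∈ Finset.univ.filter (fun v => 𝒳.toNode v = b), (N.mult u v : ℝ)) * m a b := by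
      intro u hu
      rw [Finset.sum_mul]
      refine Finset.sum_congr rfl fun v hv => ?_
      rw [(Finset.mem_filter.mp hu).2, (Finset.mem_filter.mp hv).2]
    rw [Finset.sum_congr rfl h2, ← Finset.sum_mul]
    by_cases hab : a = b
    · subst hab
      rw [hm, mul_zero, mul_zero]
    · simp only [network, if_neg hab]
      push_cast
      rfl
  unfold cost
  congr 1
  have h3 : ∀ a, ∑ b, (𝒳.network.mult a b : ℝ) * m a b =
      ∑ u ∈ Finset.univ.filter (fun u => 𝒳.toNode u = a),
        ∑ v, (N.mult u v : ℝ) * m (𝒳.toNode u) (𝒳.toNode v) := by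
    intro a
    simp only [h1]
    rw [Finset.sum_comm]
    exact Finset.sum_congr rfl fun u _ => Finset.sum_fiberwise _ _ _
  simp only [h3]
  exact Finset.sum_fiberwise _ _ _

/-- The cuts of the contracted network are the cuts along unions of its nodes. -/
theorem network_d (Z : Finset 𝒳.Node) :
    𝒳.network.d Z = N.d (Finset.univ.filter fun v => 𝒳.toNode v ∈ Z) := by
  have : (𝒳.network.d Z : ℝ) = N.d (Finset.univ.filter fun v => 𝒳.toNode v ∈ Z) := by
    rw [← cost_cutMetric, ← cost_cutMetric, 𝒳.network_cost (by simp [cutMetric])]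
    congr 1
    funext u v
    simp [cutMetric]
  exact_mod_cast this

theorem IsDualMetric.comp_toNode (hK : N.IsKClutter) {m : 𝒳.Node → 𝒳.Node → ℝ}
    (hm : 𝒳.network.IsDualMetric m) :
    N.IsDualMetric fun u v => m (𝒳.toNode u) (𝒳.toNode v) where
  self _ := hm.self _
  symm _ _ := hm.symm _ _
  triangle _ _ _ := hm.triangle _ _ _
  reward_le s hs t ht hst := by
    by_cases h : 𝒳.toNode s = 𝒳.toNode t
    · have hz := (𝒳.eq_or_isZeroPair hs ht h).resolve_left hst
      have := hz.rewardMetric_eq_zero ht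
      rw [rewardMetric, if_neg hst] at this
      rw [this]
      exact hm.nonneg _ _
    · rw [← 𝒳.network_reward hK hs ht]
      exact hm.reward_le _ (𝒳.toNode_mem_T hs) _ (𝒳.toNode_mem_T ht) h

/-- An optimal dual solution of the contracted network, seen on the original nodes. -/
theorem exists_isDualMetric_cost_le_theta (hK : N.IsKClutter) :
    ∃ m, N.IsDualMetric m ∧ (∀ X ∈ 𝒳.members, ∀ u ∈ X, ∀ v ∈ X, m u v = 0) ∧
      N.cost m ≤ 𝒳.theta := by
  obtain ⟨m, hm, hc⟩ := 𝒳.network.exists_isDualMetric_cost_le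
  refine ⟨_, IsDualMetric.comp_toNode 𝒳 hK hm, fun X hX u hu v hv => ?_, ?_⟩
  · simp only [𝒳.toNode_eq_iff.mpr (Or.inr ⟨X, hX, hu, hv⟩), hm.self]
  · rw [← 𝒳.network_cost hm.self]
    exact hc

/-- Contraction does not lower the maximum reward. -/
theorem theta_le_theta (hK : N.IsKClutter) : N.theta ≤ 𝒳.theta := by
  obtain ⟨m, hm, -, hc⟩ := 𝒳.exists_isDualMetric_cost_le_theta hK
  exact (theta_le_cost hm).trans hc

/-- A feasible pseudo-metric that vanishes on the members of an expansion descends to the contracted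
network. -/
theorem theta_le_cost_of_eq_zero (hK : N.IsKClutter) {m : V → V → ℝ} (hm : N.IsDualMetric m)
    (h0 : ∀ X ∈ 𝒳.members, ∀ u ∈ X, ∀ v ∈ X, m u v = 0) : 𝒳.theta ≤ N.cost m := by
  have h0' : ∀ u v, 𝒳.toNode u = 𝒳.toNode v → m u v = 0 := by
    intro u v h
    obtain rfl | ⟨X, hX, hu, hv⟩ := 𝒳.toNode_eq_iff.mp h
    · exact hm.self _
    · exact h0 X hX u hu v hv
  choose r hr using 𝒳.toNode_surjective
  have hr' : ∀ u v, m (r (𝒳.toNode u)) (r (𝒳.toNode v)) = m u v := by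
    intro u v
    have h1 := h0' _ _ (hr (𝒳.toNode u))
    have h2 := h0' _ _ (hr (𝒳.toNode v))
    have h3 := hm.symm u (r (𝒳.toNode u))
    have h4 := hm.symm v (r (𝒳.toNode v))
    have h5 := hm.triangle (r (𝒳.toNode u)) u (r (𝒳.toNode v))
    have h6 := hm.triangle u v (r (𝒳.toNode v))
    have h7 := hm.triangle u (r (𝒳.toNode u)) v
    have h8 := hm.triangle (r (𝒳.toNode u)) (r (𝒳.toNode v)) v
    linarith
  have hd : 𝒳.network.IsDualMetric fun a b => m (r a) (r b) := by
    refine ⟨fun _ => hm.self _, fun _ _ => hm.symm _ _, fun _ _ _ => hm.triangle _ _ _, ?_⟩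
    intro a ha b hb hab
    obtain ⟨s, hs, rfl⟩ := 𝒳.mem_network_T.mp ha
    obtain ⟨t, ht, rfl⟩ := 𝒳.mem_network_T.mp hb
    rw [𝒳.network_reward hK hs ht, hr']
    exact hm.reward_le s hs t ht fun h => hab (h ▸ rfl)
  refine (Network.theta_le_cost hd).trans_eq ?_
  rw [𝒳.network_cost hd.self]
  simp only [hr']

theorem filter_toNode_eq {X : Finset V} (hX : X ∈ 𝒳.members) {t : V} (ht : t ∈ X) :
    (Finset.univ.filter fun v => 𝒳.toNode v = 𝒳.toNode t) = X := by
  ext v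
  simp only [Finset.mem_filter, Finset.mem_univ, true_and, toNode_eq_iff]
  constructor
  · rintro (rfl | ⟨Y, hY, hv, ht'⟩)
    · exact ht
    · by_contra hvX
      exact Finset.disjoint_left.mp (𝒳.disjoint X hX Y hY fun h => hvX (h ▸ hv)) ht ht'
  · exact fun hv => Or.inr ⟨X, hX, hv, ht⟩

theorem value_eq_cutValue : 𝒳.value = 𝒳.network.cutValue := by
  unfold value cutValue
  congr 2
  symm
  refine Finset.sum_bij (fun a _ => Finset.univ.filter fun v => 𝒳.toNode v = a) ?_ ?_ ?_ ?_
  · intro a ha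
    obtain ⟨t, ht, rfl⟩ := 𝒳.mem_network_T.mp ha
    obtain ⟨X, hX, htX⟩ := 𝒳.cover t ht
    rwa [𝒳.filter_toNode_eq hX htX]
  · intro a _ b _ h
    obtain ⟨v, rfl⟩ := 𝒳.toNode_surjective a
    have : v ∈ Finset.univ.filter fun w => 𝒳.toNode w = b := h ▸ by simp
    simpa using this
  · intro X hX
    obtain ⟨t, ht⟩ := 𝒳.nonempty X hX
    rw [Finset.mem_inter] at ht
    exact ⟨𝒳.toNode t, 𝒳.toNode_mem_T ht.2, 𝒳.filter_toNode_eq hX ht.1⟩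
  · intro a _
    rw [𝒳.network_d]
    simp

end Expansion

/-! ### The frame of a K-clutter -/

theorem NoZeroPairs.anticlique_unique (h0 : N.NoZeroPairs) {s t : V} (hst : s ≠ t)
    {A B : Finset V} (hA : A ∈ N.anticliques) (hB : B ∈ N.anticliques) (hsA : s ∈ A) (htA : t ∈ A)
    (hsB : s ∈ B) (htB : t ∈ B) : A = B := by
  by_contra hAB
  refine h0 s t ⟨hst, Finset.one_lt_card.mpr ⟨A, ?_, B, ?_, hAB⟩⟩ <;> simp [*]

/-- Three terminals that are pairwise covered by anticliques are covered by one of them. -/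
theorem anticlique_eq_of_triangle (hK : N.IsKClutter) {s t u : V} (hst : s ≠ t)
    (htu : t ≠ u) (h0 : N.NoZeroPairs) {A B C : Finset V} (hA : A ∈ N.anticliques)
    (hB : B ∈ N.anticliques) (hC : C ∈ N.anticliques) (hsA : s ∈ A) (htA : t ∈ A) (htB : t ∈ B)
    (huB : u ∈ B) (hsC : s ∈ C) (huC : u ∈ C) : A = B := by
  by_contra hAB
  by_cases hAC : A = C
  · subst hAC
    exact hAB (h0.anticlique_unique htu hA hB htA huC htB huB)
  by_cases hBC : B = C
  · subst hBC
    exact hAB (h0.anticlique_unique hst hA hB hsA htA hsC htB)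
  have := (hK A hA B hB C hC hAB hAC hBC ⟨t, by simp [*]⟩ ⟨s, by simp [*]⟩ ⟨u, by simp [*]⟩).1
  have hs : s ∈ A ∩ B := this ▸ Finset.mem_inter.mpr ⟨hsA, hsC⟩
  exact hAB (h0.anticlique_unique hst hA hB hsA htA (Finset.mem_inter.mp hs).2 htB)

/-- The vertices of the frame: a center, the anticliques, and the terminals. In the frame the
center is adjacent to all anticliques, and an anticlique to its members. -/
inductive Position (N : Network V) where
  | center : Position N
  | anti (A : Finset V) (hA : A ∈ N.anticliques) : Position N
  | term (t : V) (ht : t ∈ N.T) : Position N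

namespace Position

/-- The number of edges of a shortest path in the frame. -/
def dist : Position N → Position N → ℕ
  | center, center => 0
  | center, anti _ _ => 1
  | center, term _ _ => 2
  | anti _ _, center => 1
  | anti A _, anti B _ => if A = B then 0 else 2
  | anti A _, term t _ => if t ∈ A then 1 else 3
  | term _ _, center => 2
  | term t _, anti A _ => if t ∈ A then 1 else 3
  | term s _, term t _ => if s = t then 0 else if ∃ A ∈ N.anticliques, s ∈ A ∧ t ∈ A then 2 else 4

/-- The distance from the center of the frame. -/
def height : Position N → ℕ
  | center => 0
  | anti _ _ => 1
  | term _ _ => 2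

/-- The anticliques that a position meets: the neighbours of a terminal in the frame, or the
anticlique itself. -/
def star : Position N → Finset (Finset V)
  | center => ∅
  | anti A _ => {A}
  | term t _ => N.anticliques.filter fun A => t ∈ A

theorem dist_self (p : Position N) : p.dist p = 0 := by
  cases p <;> simp [dist]

theorem dist_comm (p q : Position N) : p.dist q = q.dist p := by
  cases p <;> cases q <;> simp [dist, eq_comm, and_comm]

theorem card_star_inter_le (h0 : N.NoZeroPairs) {p q : Position N} (hpq : p ≠ q) :
    (p.star ∩ q.star).card ≤ 1 := by
  rw [Finset.card_le_one]
  intro A hA B hB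
  rw [Finset.mem_inter] at hA hB
  cases p <;> cases q <;> simp only [star, Finset.notMem_empty, Finset.mem_singleton,
    Finset.mem_filter, false_and, and_false] at hA hB <;> try (simp_all; done)
  refine h0.anticlique_unique ?_ hA.1.1 hB.1.1 hA.1.2 hA.2.2 hB.1.2 hB.2.2
  rintro rfl
  exact hpq rfl

/-- Two distinct positions meet either at the center or at an anticlique below both. -/
theorem dist_eq (h0 : N.NoZeroPairs) {p q : Position N} (hpq : p ≠ q) :
    p.dist q + 2 * (p.star ∩ q.star).card = p.height + q.height := by
  have h1 := card_star_inter_le h0 hpq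
  cases p with
  | center => cases q <;> simp [dist, star, height]
  | anti A hA =>
    cases q with
    | center => simp [dist, star, height]
    | anti B hB =>
      have : A ≠ B := by rintro rfl; exact hpq rfl
      simp [dist, star, height, this]
    | term t ht =>
      by_cases htA : t ∈ A <;> simp [dist, star, height, htA, hA]
  | term s hs =>
    cases q with
    | center => simp [dist, star, height]
    | anti A hA =>
      by_cases htA : s ∈ A <;> simp [dist, star, height, htA, hA]
    | term t ht =>
      have hst : s ≠ t := by rintro rfl; exact hpq rfl
      by_cases hc : ∃ A ∈ N.anticliques, s ∈ A ∧ t ∈ A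
      · obtain ⟨A, hA, hsA, htA⟩ := hc
        have : 0 < ((term s hs).star ∩ (term t ht).star).card :=
          Finset.card_pos.mpr ⟨A, by simp [star, *]⟩
        have hd : (term s hs).dist (term t ht) = 2 := by
          simp only [dist, if_neg hst]
          exact if_pos ⟨A, hA, hsA, htA⟩
        simp only [hd, height]
        omega
      · have : (term s hs).star ∩ (term t ht).star = ∅ := by
          rw [Finset.eq_empty_iff_forall_notMem]
          intro A hA
          simp only [star, Finset.mem_inter, Finset.mem_filter] at hA
          exact hc ⟨A, hA.1.1, hA.1.2, hA.2.2⟩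
        simp only [this, height, dist, if_neg hst, if_neg hc, Finset.card_empty]

theorem dist_triangle (h0 : N.NoZeroPairs) (p q r : Position N) :
    p.dist r ≤ p.dist q + q.dist r := by
  by_cases hpr : p = r
  · rw [hpr, dist_self]; exact Nat.zero_le _
  by_cases hpq : p = q
  · rw [hpq, dist_self, zero_add]
  by_cases hqr : q = r
  · rw [hqr, dist_self, add_zero]
  have e1 := dist_eq h0 hpr
  have e2 := dist_eq h0 hpq
  have e3 := dist_eq h0 hqr
  have l2 := card_star_inter_le h0 hpq
  have l3 := card_star_inter_le h0 hqr
  suffices (p.star ∩ q.star).card + (q.star ∩ r.star).card ≤ q.height + (p.star ∩ r.star).card by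
    omega
  cases q with
  | center => simp [star]
  | term t ht => simp only [height]; omega
  | anti A hA =>
    by_cases h1 : A ∈ p.star
    · by_cases h2 : A ∈ r.star
      · have : 0 < (p.star ∩ r.star).card := Finset.card_pos.mpr ⟨A, by simp [h1, h2]⟩
        simp only [height]; omega
      · have : (anti A hA).star ∩ r.star = ∅ :=
          Finset.singleton_inter_of_notMem h2
        rw [this]
        simp only [height, Finset.card_empty]; omega
    · have : p.star ∩ (anti A hA).star = ∅ :=
        Finset.inter_singleton_of_notMem h1
      rw [this]
      simp only [height, Finset.card_empty]; omega

/-- Among the terminals of a network without zero pairs, the frame realizes four times the reward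
function. -/
theorem dist_term_term (h0 : N.NoZeroPairs) {s t : V} (hs : s ∈ N.T) (ht : t ∈ N.T) (hst : s ≠ t) :
    ((term s hs).dist (term t ht) : ℝ) = 4 * N.reward s t := by
  have h2 : ¬ 2 ≤ N.coverNumber s t := fun h => h0 s t ⟨hst, h⟩
  rw [reward_eq_coverNumber hs ht]
  simp only [dist, if_neg hst]
  by_cases hc : N.coverNumber s t = 0
  · rw [if_pos hc, if_neg]
    · norm_num
    · rw [coverNumber_eq_zero_iff] at hc
      rintro ⟨A, hA, h1, h2⟩
      exact hc A hA h1 h2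
  · rw [if_neg hc, if_pos (show N.coverNumber s t = 1 by omega), if_pos]
    · norm_num
    · rw [coverNumber_eq_zero_iff] at hc
      push Not at hc
      exact hc

end Position

/-- The pseudo-metric induced on the nodes by a map to the frame, whose edges have
length `1 / 4`. -/
def frameMetric (φ : V → Position N) (x y : V) : ℝ := 1 / 4 * ((φ x).dist (φ y) : ℝ)

theorem isDualMetric_frameMetric (h0 : N.NoZeroPairs) {φ : V → Position N}
    (hφ : ∀ t (ht : t ∈ N.T), φ t = .term t ht) : N.IsDualMetric (frameMetric φ) where
  self x := by simp [frameMetric, Position.dist_self]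
  symm x y := by simp only [frameMetric, Position.dist_comm]
  triangle x y z := by
    have := Position.dist_triangle h0 (φ x) (φ y) (φ z)
    have : ((φ x).dist (φ z) : ℝ) ≤ (φ x).dist (φ y) + (φ y).dist (φ z) := by exact_mod_cast this
    unfold frameMetric
    linarith
  reward_le s hs t ht hst := by
    rw [frameMetric, hφ s hs, hφ t ht, Position.dist_term_term h0 hs ht hst]
    linarith

/-- The number of anticliques containing `t`. -/
def starDegree (N : Network V) (t : V) : ℕ := (N.anticliques.filter fun A => t ∈ A).card

theorem sum_sum_anticliques (N : Network V) (g : V → ℝ) :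
    ∑ A ∈ N.anticliques, ∑ t ∈ A, g t = ∑ t ∈ N.T, (N.starDegree t : ℝ) * g t := by
  rw [Finset.sum_comm' (t' := N.T) (s' := fun t => N.anticliques.filter fun A => t ∈ A)]
  · simp [starDegree]
  · intro A t
    simp only [Finset.mem_filter]
    exact ⟨fun h => ⟨h, subset_of_mem_anticliques h.1 h.2⟩, fun h => h.1⟩

theorem cutValue_eq (N : Network V) : N.cutValue = 1 / 4 *
    (∑ A ∈ N.anticliques, (N.lam A : ℝ) +
      ∑ t ∈ N.T, (2 * (N.d {t} : ℝ) - N.starDegree t * N.lam {t})) := by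
  unfold cutValue beta
  rw [← Finset.sum_div, Finset.sum_sub_distrib, sum_sum_anticliques, Finset.sum_sub_distrib,
    ← Finset.mul_sum]
  ring

/-- If the terminals are themselves minimum cuts and a map to the frame takes only the terminals to
terminals, then it costs at least the value of the min-max formula: its distances are sums of the
cuts around the stars of the anticliques, corrected by the cuts around the terminals. -/
theorem cutValue_le_cost_frameMetric (h0 : N.NoZeroPairs) {φ : V → Position N}
    (hφ : ∀ t (ht : t ∈ N.T), φ t = .term t ht) (hφ' : ∀ x t ht, φ x = .term t ht → x = t)
    (hlam : ∀ t ∈ N.T, N.d {t} = N.lam {t}) : N.cutValue ≤ N.cost (frameMetric φ) := by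
  have hpt : ∀ x y, 1 / 4 * (∑ A ∈ N.anticliques,
      cutMetric (Finset.univ.filter fun z => A ∈ (φ z).star) x y +
        ∑ t ∈ N.T, (2 - (N.starDegree t : ℝ)) * cutMetric {t} x y) ≤ frameMetric φ x y := by
    intro x y
    refine mul_le_mul_of_nonneg_left ?_ (by norm_num)
    by_cases hxy : x = y
    · subst hxy; simp [cutMetric]
    by_cases hpq : φ x = φ y
    · rw [Finset.sum_eq_zero (fun A _ => by simp [cutMetric, hpq]), Finset.sum_eq_zero, zero_add]
      · positivity
      · intro t ht
        have : ∀ z, ¬ z = t → φ z = φ t → False := fun z h h' => h (hφ' z t ht (h' ▸ hφ t ht))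
        have h1 : ¬ x = t := by
          rintro rfl
          exact hxy (hφ' y x ht (hpq ▸ hφ x ht)).symm
        have h2 : ¬ y = t := by
          rintro rfl
          exact hxy (hφ' x y ht (hpq ▸ hφ y ht))
        simp [cutMetric, h1, h2]
    have e := Position.dist_eq h0 hpq
    have hsub : ∀ p : Position N, p.star ⊆ N.anticliques := by
      intro p
      cases p <;> simp [Position.star, *]
    have hT : ∀ z, (((φ z).star.card : ℕ) : ℝ) +
        (∑ t ∈ N.T, if z = t then (2 - (N.starDegree t : ℝ)) else 0) = (φ z).height := by
      intro z
      by_cases hz : z ∈ N.T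
      · rw [Finset.sum_ite_eq, if_pos hz, hφ z hz]
        simp [Position.star, Position.height, starDegree]
      · rw [Finset.sum_ite_eq, if_neg hz]
        cases hp : φ z with
        | center => simp [Position.star, Position.height]
        | anti A hA => simp [Position.star, Position.height]
        | term t ht => exact absurd (hφ' z t ht hp ▸ ht) hz
    have hA : ∑ A ∈ N.anticliques, cutMetric (Finset.univ.filter fun z => A ∈ (φ z).star) x y =
        ((φ x).star.card : ℝ) + (φ y).star.card - 2 * ((φ x).star ∩ (φ y).star).card := by
      have h1 : ∀ A ∈ N.anticliques,
          cutMetric (Finset.univ.filter fun z => A ∈ (φ z).star) x y =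
            (if A ∈ (φ x).star then (1 : ℝ) else 0) + (if A ∈ (φ y).star then (1 : ℝ) else 0) -
              2 * (if A ∈ (φ x).star ∩ (φ y).star then (1 : ℝ) else 0) := by
        intro A _
        by_cases h1 : A ∈ (φ x).star <;> by_cases h2 : A ∈ (φ y).star <;>
          norm_num [cutMetric, h1, h2]
      rw [Finset.sum_congr rfl h1, Finset.sum_sub_distrib, Finset.sum_add_distrib,
        ← Finset.mul_sum]
      simp only [Finset.sum_ite_mem, Finset.sum_const, nsmul_eq_mul, mul_one,
        Finset.inter_eq_right.mpr (hsub _),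
        Finset.inter_eq_right.mpr (Finset.inter_subset_left.trans (hsub (φ x)))]
    have hT2 : ∑ t ∈ N.T, (2 - (N.starDegree t : ℝ)) * cutMetric {t} x y =
        (∑ t ∈ N.T, if x = t then (2 - (N.starDegree t : ℝ)) else 0) +
          ∑ t ∈ N.T, if y = t then (2 - (N.starDegree t : ℝ)) else 0 := by
      rw [← Finset.sum_add_distrib]
      refine Finset.sum_congr rfl fun t _ => ?_
      by_cases h1 : x = t <;> by_cases h2 : y = t
      · exact absurd (h1.trans h2.symm) hxy
      all_goals simp [cutMetric, h1, h2]
    have e' : ((φ x).dist (φ y) : ℝ) + 2 * ((φ x).star ∩ (φ y).star).card =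
      (φ x).height + (φ y).height := by exact_mod_cast e
    rw [hA, hT2]
    linarith [hT x, hT y]
  refine le_trans ?_ (cost_mono fun x y _ => hpt x y)
  rw [cost_const_mul, cost_add, cost_sum, cost_sum, cutValue_eq]
  simp only [cost_const_mul, cost_cutMetric]
  refine mul_le_mul_of_nonneg_left (add_le_add (Finset.sum_le_sum fun A hA => ?_)
    (Finset.sum_le_sum fun t ht => ?_)) (by norm_num)
  · have : (Finset.univ.filter fun z => A ∈ (φ z).star) ∩ N.T = A := by
      ext t
      simp only [Finset.mem_inter, Finset.mem_filter, Finset.mem_univ, true_and]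
      constructor
      · rintro ⟨h, ht⟩
        rw [hφ t ht] at h
        exact (Finset.mem_filter.mp h).2
      · intro h
        have ht := subset_of_mem_anticliques hA h
        rw [hφ t ht]
        exact ⟨Finset.mem_filter.mpr ⟨hA, h⟩, ht⟩
    exact_mod_cast lam_le this
  · rw [hlam t ht]
    exact le_of_eq (by ring)

/-! ### The min-max formula bounds `θ` from above -/

/-- A minimum cut around `A` with the fewest nodes. -/
theorem exists_minimum_cut {A : Finset V} (hA : A ⊆ N.T) : ∃ X : Finset V, X ∩ N.T = A ∧
    N.d X = N.lam A ∧ ∀ Y : Finset V, Y ∩ N.T = A → N.d Y = N.lam A → X.card ≤ Y.card := by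
  obtain ⟨X₀, hX₀⟩ := exists_d_eq_lam hA
  obtain ⟨X, hX, hmin⟩ := Finset.exists_min_image
    (Finset.univ.filter fun X : Finset V => X ∩ N.T = A ∧ N.d X = N.lam A) Finset.card
    ⟨X₀, by simpa using hX₀⟩
  simp only [Finset.mem_filter, Finset.mem_univ, true_and] at hX hmin
  exact ⟨X, hX.1, hX.2, fun Y h1 h2 => hmin Y ⟨h1, h2⟩⟩

/-- Minimum cuts of least size around disjoint sets of terminals are disjoint. -/
theorem disjoint_of_minimum_cut {A B X Y : Finset V} (hAB : Disjoint A B) (hXT : X ∩ N.T = A)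
    (hXd : N.d X = N.lam A)
    (hX : ∀ Z : Finset V, Z ∩ N.T = A → N.d Z = N.lam A → X.card ≤ Z.card)
    (hYT : Y ∩ N.T = B) (hYd : N.d Y = N.lam B) : Disjoint X Y := by
  have hXY : ∀ x ∈ N.T, x ∈ X → x ∉ Y := fun x hx h h' =>
    Finset.disjoint_left.mp hAB (hXT ▸ Finset.mem_inter.mpr ⟨h, hx⟩)
      (hYT ▸ Finset.mem_inter.mpr ⟨h', hx⟩)
  have h1 : (X \ Y) ∩ N.T = A := by
    rw [← hXT]; ext x; simp only [Finset.mem_inter, Finset.mem_sdiff]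
    exact ⟨fun h => ⟨h.1.1, h.2⟩, fun h => ⟨⟨h.1, hXY x h.2 h.1⟩, h.2⟩⟩
  have h2 : (Y \ X) ∩ N.T = B := by
    rw [← hYT]; ext x; simp only [Finset.mem_inter, Finset.mem_sdiff]
    exact ⟨fun h => ⟨h.1.1, h.2⟩, fun h => ⟨⟨h.1, fun h' => hXY x h.2 h' h.1⟩, h.2⟩⟩
  have h3 := N.d_sdiff_add_d_sdiff_le X Y
  have h4 := lam_le h1
  have h5 := lam_le h2
  have h6 := hX _ h1 (by omega)
  have h7 : X \ Y = X := Finset.eq_of_subset_of_card_le Finset.sdiff_subset h6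
  exact Finset.sdiff_eq_self_iff_disjoint.mp h7

/-- A family of pairwise intersecting anticliques has a position in the frame. -/
theorem exists_position (hK : N.IsKClutter) (I : Finset (Finset V)) (hI : I ⊆ N.anticliques)
    (hint : ∀ A ∈ I, ∀ B ∈ I, A ≠ B → (A ∩ B).Nonempty) :
    ∃ p : Position N, I ⊆ p.star ∧ p.height = min 2 I.card := by
  rcases lt_trichotomy I.card 1 with h | h | h
  · have : I = ∅ := by rw [← Finset.card_eq_zero]; omega
    exact ⟨.center, by simp [this], by simp [this, Position.height]⟩
  · obtain ⟨A, rfl⟩ := Finset.card_eq_one.mp h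
    exact ⟨.anti A (hI (by simp)), by simp [Position.star], by simp [Position.height]⟩
  · obtain ⟨A, hA, B, hB, hAB⟩ := Finset.one_lt_card.mp h
    obtain ⟨t, ht⟩ := hint A hA B hB hAB
    have ht' := Finset.mem_inter.mp ht
    refine ⟨.term t (subset_of_mem_anticliques (hI hA) ht'.1), fun C hC => ?_, ?_⟩
    · refine Finset.mem_filter.mpr ⟨hI hC, ?_⟩
      by_cases hAC : A = C
      · exact hAC ▸ ht'.1
      by_cases hBC : B = C
      · exact hBC ▸ ht'.2
      have := (hK A (hI hA) B (hI hB) C (hI hC) hAB hAC hBC (hint _ hA _ hB hAB)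
        (hint _ hA _ hC hAC) (hint _ hB _ hC hBC)).1
      exact (Finset.mem_inter.mp (this ▸ ht)).2
    · simp only [Position.height]
      omega

theorem starDegree_pos {t : V} (ht : t ∈ N.T) : 0 < N.starDegree t := by
  obtain ⟨A, hA, htA⟩ := exists_anticlique_mem ht
  exact Finset.card_pos.mpr ⟨A, Finset.mem_filter.mpr ⟨hA, htA⟩⟩

/-- Every network without zero pairs has a feasible pseudo-metric that costs no more than the value
of the min-max formula. It comes from a map to the frame which places a node according to the
minimum cuts around the anticliques that contain it. -/
theorem theta_le_cutValue (hK : N.IsKClutter) (h0 : N.NoZeroPairs) : N.theta ≤ N.cutValue := by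
  have hD : ∀ A : Finset V, ∃ X : Finset V, A ∈ N.anticliques → X ∩ N.T = A ∧
      N.d X = N.lam A ∧ ∀ Y : Finset V, Y ∩ N.T = A → N.d Y = N.lam A → X.card ≤ Y.card := by
    intro A
    by_cases hA : A ∈ N.anticliques
    · obtain ⟨X, hX⟩ := exists_minimum_cut (subset_of_mem_anticliques hA)
      exact ⟨X, fun _ => hX⟩
    · exact ⟨∅, fun h => absurd h hA⟩
  choose D hD using hD
  let I : V → Finset (Finset V) := fun x => N.anticliques.filter fun A => x ∈ D A
  have hIT : ∀ t ∈ N.T, I t = N.anticliques.filter fun A => t ∈ A := by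
    intro t ht
    refine Finset.filter_congr fun A hA => ?_
    conv_rhs => rw [← (hD A hA).1]
    simp [ht]
  have hint : ∀ x, ∀ A ∈ I x, ∀ B ∈ I x, A ≠ B → (A ∩ B).Nonempty := by
    intro x A hA B hB _
    rw [Finset.mem_filter] at hA hB
    by_contra h
    have hdis : Disjoint A B := by
      rw [Finset.disjoint_iff_inter_eq_empty]
      exact Finset.not_nonempty_iff_eq_empty.mp h
    have hA' := hD A hA.1
    have hB' := hD B hB.1
    exact Finset.disjoint_left.mp (disjoint_of_minimum_cut hdis hA'.1 hA'.2.1 hA'.2.2 hB'.1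
      hB'.2.1) hA.2 hB.2
  have hpos := fun x => exists_position hK (I x) (Finset.filter_subset _ _) (hint x)
  choose p hpI hph using hpos
  have hpT : ∀ s (hs : s ∈ N.T) t ht, 2 ≤ (I s).card → p s = .term t ht → s = t := by
    intro s hs t ht h2 hp
    by_contra hst
    have hsub := hpI s
    rw [hp, hIT s hs] at hsub
    refine h0 s t ⟨hst, ?_⟩
    rw [hIT s hs] at h2
    refine h2.trans (Finset.card_le_card fun A hA => ?_)
    have h3 := Finset.mem_filter.mp hA
    exact Finset.mem_filter.mpr ⟨h3.1, h3.2, (Finset.mem_filter.mp (hsub hA)).2⟩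
  -- `p` places a terminal contained in a single anticlique at that anticlique; `φ` moves it to
  -- itself, which costs one step in the frame
  let φ : V → Position N := fun x => if hx : x ∈ N.T then .term x hx else p x
  have hφ : ∀ t (ht : t ∈ N.T), φ t = .term t ht := fun t ht => dif_pos ht
  let τ : V → ℝ := fun x => if x ∈ N.T then if N.starDegree x = 1 then 1 else 0 else 0
  have hφp : ∀ x, ((φ x).dist (p x) : ℝ) ≤ τ x := by
    intro x
    by_cases hx : x ∈ N.T
    · by_cases hp : φ x = p x
      · rw [hp, Position.dist_self]
        simp only [τ]; split_ifs <;> norm_num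
      · have e := Position.dist_eq h0 hp
        have l := Position.card_star_inter_le h0 hp
        have hs : (φ x).star = I x := by rw [hφ x hx, hIT x hx]; rfl
        have hk : (I x).card = N.starDegree x := by rw [hIT x hx]; rfl
        have hkpos := starDegree_pos hx
        rw [hs, Finset.inter_eq_left.mpr (hpI x)] at e l
        have h1 : N.starDegree x = 1 := by omega
        rw [hφ x hx, hph] at e
        rw [hφ x hx]
        simp only [Position.height] at e
        have h2 : (Position.term x hx).dist (p x) = 1 := by omega
        simp [τ, hx, h1, h2]
    · simp [φ, τ, hx, Position.dist_self]
  -- a node at a terminal that lies in more than two of the cuts has an excess, which the frame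
  -- metric does not see; it is a potential around that terminal and costs at least a multiple of
  -- `λ(t)`
  let e : V → V → ℕ := fun t x => if ∃ ht, p x = .term t ht then (I x).card - 2 else 0
  have he_sum : ∀ x y, ((p x).dist (p y) : ℝ) + ∑ t ∈ N.T, |(e t x : ℝ) - e t y| ≤
      ∑ A ∈ N.anticliques, cutMetric (D A) x y := by
    intro x y
    have hsym : ∑ A ∈ N.anticliques, cutMetric (D A) x y =
        ((I x).card : ℝ) + (I y).card - 2 * (I x ∩ I y).card := by
      have h1 : ∀ A ∈ N.anticliques, cutMetric (D A) x y =
          (if x ∈ D A then (1 : ℝ) else 0) + (if y ∈ D A then (1 : ℝ) else 0) -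
            2 * (if x ∈ D A ∧ y ∈ D A then (1 : ℝ) else 0) := by
        intro A _
        by_cases h1 : x ∈ D A <;> by_cases h2 : y ∈ D A <;> norm_num [cutMetric, h1, h2]
      rw [Finset.sum_congr rfl h1, Finset.sum_sub_distrib, Finset.sum_add_distrib,
        ← Finset.mul_sum]
      simp only [Finset.sum_boole, I, ← Finset.filter_and]
    have hle1 : ((I x ∩ I y).card : ℝ) ≤ (I x).card := by
      exact_mod_cast Finset.card_le_card Finset.inter_subset_left
    have hle2 : ((I x ∩ I y).card : ℝ) ≤ (I y).card := by
      exact_mod_cast Finset.card_le_card Finset.inter_subset_right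
    have hes : ∀ z, ∑ t ∈ N.T, (e t z : ℝ) ≤ ((I z).card : ℝ) - (p z).height := by
      intro z
      have hz := hph z
      by_cases hp : ∃ t ht, p z = .term t ht
      · obtain ⟨t, ht, hp⟩ := hp
        have h2 : 2 ≤ (I z).card := by
          rw [hp] at hz; simp only [Position.height] at hz; omega
        have : ∀ s ∈ N.T, (e s z : ℝ) = if t = s then ((I z).card : ℝ) - 2 else 0 := by
          intro s hs
          by_cases hst : t = s
          · subst hst
            simp [e, hp, ht, Nat.cast_sub h2]
          · simp [e, hp, hst]
        rw [Finset.sum_congr rfl this, Finset.sum_ite_eq, if_pos ht, hp]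
        simp [Position.height]
      · rw [Finset.sum_eq_zero]
        · have : ((p z).height : ℝ) ≤ (I z).card := by
            exact_mod_cast hz.le.trans (min_le_right _ _)
          linarith
        · intro t _
          have : ¬ ∃ ht, p z = .term t ht := fun ⟨ht, h⟩ => hp ⟨t, ht, h⟩
          simp [e, this]
    rw [hsym]
    by_cases hpq : p x = p y
    · rw [hpq, Position.dist_self, Nat.cast_zero, zero_add]
      have habs : |((I x).card : ℝ) - (I y).card| ≤
          ((I x).card : ℝ) + (I y).card - 2 * (I x ∩ I y).card := by
        rw [abs_le]; constructor <;> linarith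
      refine le_trans ?_ habs
      by_cases hp : ∃ t ht, p y = .term t ht
      · obtain ⟨t, ht, hp⟩ := hp
        have : ∀ s ∈ N.T, |(e s x : ℝ) - e s y| =
            if t = s then |((I x).card : ℝ) - (I y).card| else 0 := by
          intro s hs
          have hx2 : 2 ≤ (I x).card := by
            have := hph x
            rw [hpq, hp] at this; simp only [Position.height] at this; omega
          have hy2 : 2 ≤ (I y).card := by
            have := hph y
            rw [hp] at this; simp only [Position.height] at this; omega
          by_cases hst : t = s
          · subst hst
            simp [e, hpq, hp, ht, Nat.cast_sub hx2, Nat.cast_sub hy2]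
          · simp [e, hpq, hp, hst]
        rw [Finset.sum_congr rfl this, Finset.sum_ite_eq, if_pos ht]
      · rw [Finset.sum_eq_zero]
        · positivity
        · intro t _
          have : ¬ ∃ ht, p y = .term t ht := fun ⟨ht, h⟩ => hp ⟨t, ht, h⟩
          simp [e, hpq, this]
    · have hd := Position.dist_eq h0 hpq
      have hd' : ((p x).dist (p y) : ℝ) + 2 * ((p x).star ∩ (p y).star).card =
        (p x).height + (p y).height := by exact_mod_cast hd
      have hsub : ((I x ∩ I y).card : ℝ) ≤ ((p x).star ∩ (p y).star).card := by
        exact_mod_cast Finset.card_le_card (Finset.inter_subset_inter (hpI x) (hpI y))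
      have h1 : ∑ t ∈ N.T, |(e t x : ℝ) - e t y| ≤
          ∑ t ∈ N.T, (e t x : ℝ) + ∑ t ∈ N.T, (e t y : ℝ) := by
        rw [← Finset.sum_add_distrib]
        refine Finset.sum_le_sum fun t _ => (abs_sub _ _).trans ?_
        rw [Nat.abs_cast, Nat.abs_cast]
      linarith [hes x, hes y]
  have hpt : ∀ x y, frameMetric φ x y + 1 / 4 * ∑ t ∈ N.T, |(e t x : ℝ) - e t y| ≤
      1 / 4 * (∑ A ∈ N.anticliques, cutMetric (D A) x y +
        ∑ t ∈ N.T, (if N.starDegree t = 1 then (1 : ℝ) else 0) * cutMetric {t} x y) := by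
    intro x y
    by_cases hxy : x = y
    · subst hxy
      simp [frameMetric, Position.dist_self, cutMetric]
    have hτ : ∑ t ∈ N.T, (if N.starDegree t = 1 then (1 : ℝ) else 0) * cutMetric {t} x y =
        τ x + τ y := by
      have h1 : ∀ t ∈ N.T, (if N.starDegree t = 1 then (1 : ℝ) else 0) * cutMetric {t} x y =
          (if x = t then if N.starDegree t = 1 then (1 : ℝ) else 0 else 0) +
            (if y = t then if N.starDegree t = 1 then (1 : ℝ) else 0 else 0) := by
        intro t _
        by_cases h1 : x = t <;> by_cases h2 : y = t
        · exact absurd (h1.trans h2.symm) hxy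
        all_goals simp [cutMetric, h1, h2]
      rw [Finset.sum_congr rfl h1, Finset.sum_add_distrib, Finset.sum_ite_eq, Finset.sum_ite_eq]
    have t1 := Position.dist_triangle h0 (φ x) (p x) (φ y)
    have t2 := Position.dist_triangle h0 (p x) (p y) (φ y)
    have t3 : ((φ x).dist (φ y) : ℝ) ≤ (φ x).dist (p x) + (p x).dist (p y) + (p y).dist (φ y) := by
      exact_mod_cast (by omega)
    rw [Position.dist_comm (p y)] at t3
    rw [hτ, frameMetric]
    linarith [hφp x, hφp y, he_sum x y]
  have hcost : N.cost (frameMetric φ) +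
      1 / 4 * ∑ t ∈ N.T, N.cost (fun x y => |(e t x : ℝ) - e t y|) ≤
      1 / 4 * (∑ A ∈ N.anticliques, (N.lam A : ℝ) +
        ∑ t ∈ N.T, (if N.starDegree t = 1 then (1 : ℝ) else 0) * N.d {t}) := by
    have := cost_mono (N := N) fun x y _ => hpt x y
    rw [cost_add, cost_const_mul, cost_const_mul, cost_add, cost_sum, cost_sum, cost_sum] at this
    simp only [cost_const_mul, cost_cutMetric] at this
    have hlam : ∑ A ∈ N.anticliques, (N.d (D A) : ℝ) = ∑ A ∈ N.anticliques, (N.lam A : ℝ) :=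
      Finset.sum_congr rfl fun A hA => by rw [(hD A hA).2.1]
    rwa [hlam] at this
  have hexc : ∀ t ∈ N.T, ((N.starDegree t - 2 : ℕ) : ℝ) * N.lam {t} ≤
      N.cost (fun x y => |(e t x : ℝ) - e t y|) := by
    intro t ht
    have h1 : e t t = N.starDegree t - 2 := by
      have hk : (I t).card = N.starDegree t := by rw [hIT t ht]; rfl
      by_cases hp : ∃ ht, p t = .term t ht
      · simp only [e, if_pos hp, hk]
      · simp only [e, if_neg hp]
        by_contra hne
        have h2 : 2 ≤ (I t).card := by omega
        have hh := hph t
        rw [min_eq_left h2] at hh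
        cases hpt : p t with
        | center => rw [hpt] at hh; simp [Position.height] at hh
        | anti A hA => rw [hpt] at hh; simp [Position.height] at hh
        | term s hs =>
          have := hpT t ht s hs h2 hpt
          subst this
          exact hp ⟨hs, hpt⟩
    rw [← h1]
    refine mul_lam_le_cost ht (e t) fun s hs hst => ?_
    by_cases hp : ∃ ht, p s = .term t ht
    · obtain ⟨ht', hp'⟩ := hp
      by_cases h2 : 2 ≤ (I s).card
      · exact absurd (hpT s hs t ht' h2 hp') hst
      · simp only [e]
        split_ifs <;> omega
    · simp only [e, if_neg hp]
  refine (theta_le_cost (isDualMetric_frameMetric h0 hφ)).trans ?_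
  have hsum := Finset.sum_le_sum hexc
  have hlast : ∑ t ∈ N.T, (if N.starDegree t = 1 then (1 : ℝ) else 0) * N.d {t} -
      ∑ t ∈ N.T, ((N.starDegree t - 2 : ℕ) : ℝ) * N.lam {t} ≤
        ∑ t ∈ N.T, (2 * (N.d {t} : ℝ) - N.starDegree t * N.lam {t}) := by
    rw [← Finset.sum_sub_distrib]
    refine Finset.sum_le_sum fun t ht => ?_
    have hpos := starDegree_pos ht
    have hld : (N.lam {t} : ℝ) ≤ N.d {t} := by
      exact_mod_cast lam_le (Finset.singleton_inter_of_mem ht)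
    have hd0 : (0 : ℝ) ≤ N.d {t} := Nat.cast_nonneg _
    by_cases h1 : N.starDegree t = 1
    · simp only [h1, if_true]
      norm_num
      linarith
    · rw [if_neg h1, Nat.cast_sub (by omega)]
      push_cast
      linarith
  rw [cutValue_eq]
  linarith

/-! ### Rounding a pseudo-metric to a map to the frame -/

/-- The indicator of `r ≤ a`. -/
def below (r a : ℝ) : ℝ := if r ≤ a then 1 else 0

theorem intervalIntegrable_below (a c d : ℝ) :
    IntervalIntegrable (fun r => below r a) MeasureTheory.volume c d := by
  refine Antitone.intervalIntegrable fun r s hrs => ?_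
  simp only [below]
  split_ifs <;> first | (exfalso; linarith) | norm_num

theorem integral_below {a c : ℝ} (h0 : 0 ≤ a) (hc : a ≤ c) : ∫ r in (0 : ℝ)..c, below r a = a := by
  rw [← intervalIntegral.integral_add_adjacent_intervals (b := a)
    (intervalIntegrable_below _ _ _) (intervalIntegrable_below _ _ _)]
  have h1 : ∫ r in (0 : ℝ)..a, below r a = ∫ r in (0 : ℝ)..a, (1 : ℝ) := by
    refine intervalIntegral.integral_congr_ae (Filter.Eventually.of_forall fun r hr => ?_)
    rw [Set.uIoc_of_le h0] at hr
    exact if_pos hr.2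
  have h2 : ∫ r in a..c, below r a = ∫ r in a..c, (0 : ℝ) := by
    refine intervalIntegral.integral_congr_ae (Filter.Eventually.of_forall fun r hr => ?_)
    rw [Set.uIoc_of_le hc] at hr
    exact if_neg (not_le.mpr hr.1)
  rw [h1, h2]
  simp

/-- Averaging over a threshold `r`: some threshold separates the pairs `(α, β)` with total weight at
most the weighted sum of their distances, scaled by the length of the range of thresholds. -/
theorem exists_threshold {J : Type*} [Fintype J] {c α β : J → ℝ} {l : ℝ} (hl : 0 < l)
    (hα : ∀ j, 0 ≤ α j ∧ α j ≤ l) (hβ : ∀ j, 0 ≤ β j ∧ β j ≤ l) :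
    ∃ r, 0 < r ∧ r ≤ l ∧
      l * ∑ j, c j * |below r (α j) - below r (β j)| ≤ ∑ j, c j * |α j - β j| := by
  have habs : ∀ r a b, |below r a - below r b| = below r (max a b) - below r (min a b) := by
    intro r a b
    rcases le_total a b with h | h
    · rw [max_eq_right h, min_eq_left h, abs_sub_comm, abs_of_nonneg]
      simp only [below]
      split_ifs <;> first | (exfalso; linarith) | norm_num
    · rw [max_eq_left h, min_eq_right h, abs_of_nonneg]
      simp only [below]
      split_ifs <;> first | (exfalso; linarith) | norm_num
  have hint : ∀ j, IntervalIntegrable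
      (fun r => c j * |below r (α j) - below r (β j)|) MeasureTheory.volume 0 l := by
    intro j
    simp only [habs]
    exact ((intervalIntegrable_below _ _ _).sub (intervalIntegrable_below _ _ _)).const_mul _
  have hval : ∀ j, ∫ r in (0 : ℝ)..l, c j * |below r (α j) - below r (β j)| =
      c j * |α j - β j| := by
    intro j
    simp only [habs]
    rw [intervalIntegral.integral_const_mul, intervalIntegral.integral_sub
      (intervalIntegrable_below _ _ _) (intervalIntegrable_below _ _ _),
      integral_below (le_max_of_le_left (hα j).1) (max_le (hα j).2 (hβ j).2),
      integral_below (le_min (hα j).1 (hβ j).1) (min_le_of_left_le (hα j).2), max_sub_min_eq_abs,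
      abs_sub_comm]
  by_contra! hcon
  have hsum : IntervalIntegrable (fun r => ∑ j, c j * |below r (α j) - below r (β j)|)
      MeasureTheory.volume 0 l := by
    have h := IntervalIntegrable.sum (Finset.univ : Finset J) (fun j _ => hint j)
    have heq : (fun r => ∑ j, c j * |below r (α j) - below r (β j)|) =
        ∑ j, fun r => c j * |below r (α j) - below r (β j)| := by
      funext r
      simp
    rw [heq]
    exact h
  have hpos := intervalIntegral.intervalIntegral_pos_of_pos_on
    (f := fun r => (∑ j, c j * |below r (α j) - below r (β j)|) - (∑ j, c j * |α j - β j|) / l)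
    (hsum.sub intervalIntegrable_const) (fun r hr => by
      have := hcon r hr.1 hr.2.le
      rw [sub_pos, div_lt_iff₀ hl]
      linarith) hl
  rw [intervalIntegral.integral_sub hsum intervalIntegrable_const,
    intervalIntegral.integral_finsetSum fun j _ => hint j] at hpos
  simp only [hval] at hpos
  rw [intervalIntegral.integral_const, smul_eq_mul, sub_zero, mul_div_cancel₀ _ hl.ne'] at hpos
  linarith

/-- The location of a node `x` relative to the terminals: the nearest terminal `near`, an anticlique
`side` through it, and the distances `inner` and `outer`, cut off at `1 / 2`, of `x` to `near` and
to the nearest among the other terminals that share an anticlique with `near`. -/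
structure Profile (N : Network V) (m : V → V → ℝ) (x : V) where
  near : V
  side : Finset V
  inner : ℝ
  outer : ℝ
  near_mem : near ∈ N.T
  side_mem : side ∈ N.anticliques
  near_mem_side : near ∈ side
  near_le : ∀ s ∈ N.T, m x near ≤ m x s
  inner_eq : inner = min (1 / 2) (m x near)
  outer_le_half : outer ≤ 1 / 2
  outer_le : ∀ s ∈ N.T, s ≠ near → (∃ B ∈ N.anticliques, s ∈ B ∧ near ∈ B) → outer ≤ m x s
  outer_eq : outer = 1 / 2 ∨ ∃ s ∈ side, s ≠ near ∧ outer = m x s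

theorem nonempty_profile (hT : N.T.Nonempty) (m : V → V → ℝ) (x : V) :
    Nonempty (Profile N m x) := by
  obtain ⟨t, ht, htmin⟩ := Finset.exists_min_image N.T (m x) hT
  obtain ⟨A, hA, htA⟩ := exists_anticlique_mem ht
  let F := N.T.filter fun s => s ≠ t ∧ ∃ B ∈ N.anticliques, s ∈ B ∧ t ∈ B
  by_cases hF : ∃ s ∈ F, m x s ≤ 1 / 2
  · obtain ⟨s', hs', hs'2⟩ := hF
    obtain ⟨s, hs, hsmin⟩ := Finset.exists_min_image F (m x) ⟨s', hs'⟩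
    obtain ⟨hsT, hst, B, hB, hsB, htB⟩ := Finset.mem_filter.mp hs
    exact ⟨⟨t, B, _, m x s, ht, hB, htB, htmin, rfl, (hsmin s' hs').trans hs'2,
      fun s₁ h1 h2 h3 => hsmin s₁ (Finset.mem_filter.mpr ⟨h1, h2, h3⟩), Or.inr ⟨s, hsB, hst, rfl⟩⟩⟩
  · push Not at hF
    exact ⟨⟨t, A, _, 1 / 2, ht, hA, htA, htmin, rfl, le_rfl,
      fun s₁ h1 h2 h3 => (hF s₁ (Finset.mem_filter.mpr ⟨h1, h2, h3⟩)).le, Or.inl rfl⟩⟩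

namespace Profile

variable {m : V → V → ℝ} {x y : V}

/-- The first coordinate of a node: its extent from the center towards its anticlique. -/
def fstCoord (P : Profile N m x) : ℝ := (1 - P.inner - P.outer) / 2

/-- The second coordinate of a node: its extent from its anticlique towards its terminal. -/
def sndCoord (P : Profile N m x) : ℝ := (P.outer - P.inner) / 2

/-- The position of a node in the frame at the threshold `r`. -/
def position (P : Profile N m x) (r : ℝ) : Position N :=
  if r ≤ P.sndCoord then .term P.near P.near_mem
  else if r ≤ P.fstCoord then .anti P.side P.side_mem else .center

theorem reward_eq_half_or_one (h0 : N.NoZeroPairs) {s t : V} (hs : s ∈ N.T) (ht : t ∈ N.T)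
    (hst : s ≠ t) : 1 / 2 ≤ N.reward s t ∧
      ((¬ ∃ B ∈ N.anticliques, s ∈ B ∧ t ∈ B) → N.reward s t = 1) := by
  have h2 : ¬ 2 ≤ N.coverNumber s t := fun h => h0 s t ⟨hst, h⟩
  rw [reward_eq_coverNumber hs ht]
  constructor
  · split_ifs <;> first | omega | norm_num
  · intro h
    rw [if_pos]
    rw [coverNumber_eq_zero_iff]
    exact fun A hA hsA htA => h ⟨A, hA, hsA, htA⟩

theorem inner_nonneg (hm : N.IsDualMetric m) (P : Profile N m x) : 0 ≤ P.inner := by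
  rw [P.inner_eq]; exact le_min (by norm_num) (hm.nonneg _ _)

theorem inner_le_half (P : Profile N m x) : P.inner ≤ 1 / 2 := by
  rw [P.inner_eq]; exact min_le_left _ _

theorem inner_le (P : Profile N m x) {s : V} (hs : s ∈ N.T) : P.inner ≤ m x s := by
  rw [P.inner_eq]; exact (min_le_right _ _).trans (P.near_le s hs)

theorem mem_T_of_mem_side (P : Profile N m x) {s : V} (hs : s ∈ P.side) : s ∈ N.T :=
  subset_of_mem_anticliques P.side_mem hs

theorem inner_le_outer (P : Profile N m x) : P.inner ≤ P.outer := by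
  rcases P.outer_eq with h | ⟨s, hs, _, h⟩
  · rw [h]; exact P.inner_le_half
  · rw [h]; exact P.inner_le (P.mem_T_of_mem_side hs)

theorem half_le_inner_add_outer (hm : N.IsDualMetric m) (h0 : N.NoZeroPairs) (P : Profile N m x) :
    1 / 2 ≤ P.inner + P.outer := by
  have hi := P.inner_nonneg hm
  rcases P.outer_eq with h | ⟨s, hs, hne, h⟩
  · linarith
  · rcases min_choice (1 / 2) (m x P.near) with hmin | hmin
    · rw [P.inner_eq, hmin]
      linarith [P.inner_le_outer]
    · rw [P.inner_eq, hmin, h]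
      have hsT := P.mem_T_of_mem_side hs
      have h1 := (reward_eq_half_or_one h0 P.near_mem hsT hne.symm).1
      have h2 := hm.reward_le _ P.near_mem _ hsT hne.symm
      have h3 := hm.triangle P.near x s
      rw [hm.symm P.near x] at h3
      linarith

theorem coords (hm : N.IsDualMetric m) (h0 : N.NoZeroPairs) (P : Profile N m x) :
    0 ≤ P.sndCoord ∧ P.sndCoord ≤ P.fstCoord ∧ P.fstCoord ≤ 1 / 4 := by
  have h1 := P.inner_le_outer
  have h2 := P.outer_le_half
  have h3 := P.half_le_inner_add_outer hm h0
  unfold sndCoord fstCoord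
  refine ⟨?_, ?_, ?_⟩ <;> linarith

theorem inner_le_inner_add (hm : N.IsDualMetric m) (P : Profile N m x) (Q : Profile N m y) :
    P.inner ≤ Q.inner + m x y := by
  have h1 := P.inner_le_half
  have h2 := P.inner_le Q.near_mem
  have h3 := hm.triangle x y Q.near
  have h4 := hm.nonneg x y
  rw [Q.inner_eq]
  rcases min_choice (1 / 2) (m y Q.near) with h | h <;> rw [h] <;> linarith

theorem outer_le_outer_add (hm : N.IsDualMetric m) (P : Profile N m x) (Q : Profile N m y)
    (h : P.near = Q.near) : P.outer ≤ Q.outer + m x y := by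
  have h1 := P.outer_le_half
  have h4 := hm.nonneg x y
  rcases Q.outer_eq with hq | ⟨s, hs, hne, hq⟩
  · linarith
  · have h2 := P.outer_le s (Q.mem_T_of_mem_side hs) (h ▸ hne)
      ⟨_, Q.side_mem, hs, h ▸ Q.near_mem_side⟩
    have h3 := hm.triangle x y s
    linarith

theorem outer_le_inner_add (hm : N.IsDualMetric m) (P : Profile N m x) (Q : Profile N m y)
    (hne : P.near ≠ Q.near) (hc : ∃ B ∈ N.anticliques, P.near ∈ B ∧ Q.near ∈ B) :
    Q.outer ≤ P.inner + m x y := by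
  have h1 := Q.outer_le_half
  have h2 := Q.outer_le _ P.near_mem hne hc
  have h3 := hm.triangle y x P.near
  have h4 := hm.nonneg x y
  rw [hm.symm y x] at h3
  rw [P.inner_eq]
  rcases min_choice (1 / 2) (m x P.near) with h | h <;> rw [h] <;> linarith

/-- A lower bound for the distance of two nodes with terminals in a common anticlique, towards
which the second node does not lean. -/
theorem one_le_of_common (hm : N.IsDualMetric m) (hK : N.IsKClutter) (h0 : N.NoZeroPairs)
    (P : Profile N m x) (Q : Profile N m y) (hne : P.near ≠ Q.near) {B : Finset V}
    (hB : B ∈ N.anticliques) (hPB : P.near ∈ B) (hQB : Q.near ∈ B) (hside : P.near ∉ Q.side) :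
    1 ≤ P.inner + Q.outer + m x y := by
  have h1 := P.outer_le_inner_add hm Q hne ⟨B, hB, hPB, hQB⟩
  rcases Q.outer_eq with hq | ⟨s, hs, hsne, hq⟩
  · linarith
  have hsT := Q.mem_T_of_mem_side hs
  have hsP : s ≠ P.near := fun h => hside (h ▸ hs)
  have hno : ¬ ∃ C ∈ N.anticliques, s ∈ C ∧ P.near ∈ C := by
    rintro ⟨C, hC, hsC, hPC⟩
    have := anticlique_eq_of_triangle hK hsne (Ne.symm hne) h0 Q.side_mem hB hC hs
      Q.near_mem_side hQB hPB hsC hPC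
    exact hside (this ▸ hPB)
  have h2 := (reward_eq_half_or_one h0 hsT P.near_mem hsP).2 hno
  have h3 := hm.reward_le _ hsT _ P.near_mem hsP
  have h4 := hm.triangle s y P.near
  have h5 := hm.triangle y x P.near
  have h6 := hm.triangle x y s
  have h7 := P.near_le s hsT
  rw [hm.symm s y] at h4
  rw [hm.symm y x] at h5
  rw [P.inner_eq]
  rcases min_choice (1 / 2) (m x P.near) with h | h
  · have := min_eq_left_iff.mp h
    rw [h]; linarith
  · rw [h]; linarith

/-- A lower bound for the distance of two nodes with the same nearest terminal that lean towards
different anticliques. -/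
theorem one_le_of_side_ne (hm : N.IsDualMetric m) (hK : N.IsKClutter) (h0 : N.NoZeroPairs)
    (P : Profile N m x) (Q : Profile N m y) (heq : P.near = Q.near) (hside : P.side ≠ Q.side) :
    1 ≤ P.outer + Q.outer + m x y := by
  have h1 := P.outer_le_outer_add hm Q heq
  have h2 := Q.outer_le_outer_add hm P heq.symm
  rw [hm.symm y x] at h2
  rcases P.outer_eq with hp | ⟨s, hs, hsne, hp⟩
  · linarith
  rcases Q.outer_eq with hq | ⟨u, hu, hune, hq⟩
  · linarith
  have hPu : P.near ∈ Q.side := heq ▸ Q.near_mem_side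
  have hsu : s ≠ u := by
    rintro rfl
    exact hside (h0.anticlique_unique hsne P.side_mem Q.side_mem hs P.near_mem_side hu hPu)
  have hno : ¬ ∃ C ∈ N.anticliques, s ∈ C ∧ u ∈ C := by
    rintro ⟨C, hC, hsC, huC⟩
    exact hside (anticlique_eq_of_triangle hK hsne (heq ▸ hune.symm) h0 P.side_mem Q.side_mem hC hs
      P.near_mem_side hPu hu hsC huC)
  have hsT := P.mem_T_of_mem_side hs
  have huT := Q.mem_T_of_mem_side hu
  have h3 := (reward_eq_half_or_one h0 hsT huT hsu).2 hno
  have h4 := hm.reward_le _ hsT _ huT hsu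
  have h5 := hm.triangle s x u
  have h6 := hm.triangle x y u
  rw [hm.symm s x] at h5
  linarith

/-- A lower bound for the distance of two nodes whose nearest terminals share no anticlique. -/
theorem one_le_of_not_common (hm : N.IsDualMetric m) (h0 : N.NoZeroPairs)
    (P : Profile N m x) (Q : Profile N m y) (hne : P.near ≠ Q.near)
    (hc : ¬ ∃ B ∈ N.anticliques, P.near ∈ B ∧ Q.near ∈ B) :
    1 ≤ P.inner + Q.inner + m x y := by
  have h1 := P.inner_le_inner_add hm Q
  have h2 := Q.inner_le_inner_add hm P
  have h3 := (reward_eq_half_or_one h0 P.near_mem Q.near_mem hne).2 hc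
  have h4 := hm.reward_le _ P.near_mem _ Q.near_mem hne
  have h5 := hm.triangle P.near x Q.near
  have h6 := hm.triangle x y Q.near
  rw [hm.symm P.near x] at h5
  rw [hm.symm y x] at h2
  have h7 := P.inner_eq
  have h8 := Q.inner_eq
  rcases min_choice (1 / 2) (m x P.near) with h | h
  · rw [h] at h7; linarith
  · rcases min_choice (1 / 2) (m y Q.near) with h' | h'
    · rw [h'] at h8; linarith
    · rw [h] at h7; rw [h'] at h8; linarith

theorem position_cases (hm : N.IsDualMetric m) (h0 : N.NoZeroPairs) (P : Profile N m x) (r : ℝ) :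
    (P.position r = .term P.near P.near_mem ∧ below r P.sndCoord = 1 ∧ below r P.fstCoord = 1) ∨
    (P.position r = .anti P.side P.side_mem ∧ below r P.sndCoord = 0 ∧ below r P.fstCoord = 1) ∨
    (P.position r = .center ∧ below r P.sndCoord = 0 ∧ below r P.fstCoord = 0) := by
  have h := (P.coords hm h0).2.1
  by_cases h1 : r ≤ P.sndCoord
  · have h2 : r ≤ P.fstCoord := h1.trans h
    simp [position, below, h1, h2]
  · by_cases h2 : r ≤ P.fstCoord <;> simp [position, below, h1, h2]

/-- The expected distance of the positions of two nodes, for a random threshold, is at most a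
quarter of their distance: the distance of the positions is bounded by the separation of four pairs
of coordinates, which are matched according to the mutual location of the nodes. -/
theorem exists_coordinate_pairs (hm : N.IsDualMetric m) (hK : N.IsKClutter) (h0 : N.NoZeroPairs)
    (P : Profile N m x) (Q : Profile N m y) : ∃ α β : Fin 4 → ℝ,
      (∀ i, 0 ≤ α i ∧ α i ≤ 1 / 4) ∧ (∀ i, 0 ≤ β i ∧ β i ≤ 1 / 4) ∧
      (∀ r, 0 < r → ((P.position r).dist (Q.position r) : ℝ) ≤
        ∑ i, |below r (α i) - below r (β i)|) ∧ ∑ i, |α i - β i| ≤ m x y := by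
  obtain ⟨p1, p2, p3⟩ := P.coords hm h0
  obtain ⟨q1, q2, q3⟩ := Q.coords hm h0
  have hb0 : ∀ r : ℝ, 0 < r → below r 0 = 0 := fun r hr => if_neg (not_le.mpr hr)
  have i1 := P.inner_le_inner_add hm Q
  have i2 := Q.inner_le_inner_add hm P
  rw [hm.symm y x] at i2
  have bd : ∀ a b c d : ℝ, (0 ≤ a ∧ a ≤ 1 / 4) → (0 ≤ b ∧ b ≤ 1 / 4) → (0 ≤ c ∧ c ≤ 1 / 4) →
      (0 ≤ d ∧ d ≤ 1 / 4) → ∀ i : Fin 4, 0 ≤ ![a, b, c, d] i ∧ ![a, b, c, d] i ≤ 1 / 4 := by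
    intro a b c d h1 h2 h3 h4 i
    fin_cases i
    exacts [h1, h2, h3, h4]
  have z4 : (0 : ℝ) ≤ 0 ∧ (0 : ℝ) ≤ 1 / 4 := by norm_num
  have Pa : 0 ≤ P.fstCoord ∧ P.fstCoord ≤ 1 / 4 := ⟨p1.trans p2, p3⟩
  have Pb : 0 ≤ P.sndCoord ∧ P.sndCoord ≤ 1 / 4 := ⟨p1, p2.trans p3⟩
  have Qa : 0 ≤ Q.fstCoord ∧ Q.fstCoord ≤ 1 / 4 := ⟨q1.trans q2, q3⟩
  have Qb : 0 ≤ Q.sndCoord ∧ Q.sndCoord ≤ 1 / 4 := ⟨q1, q2.trans q3⟩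
  by_cases hnear : P.near = Q.near
  · have o1 := P.outer_le_outer_add hm Q hnear
    have o2 := Q.outer_le_outer_add hm P hnear.symm
    rw [hm.symm y x] at o2
    by_cases hside : P.side = Q.side
    -- same branch of the frame: equal coordinates are matched
    · refine ⟨![P.fstCoord, P.sndCoord, 0, 0], ![Q.fstCoord, Q.sndCoord, 0, 0],
        bd _ _ _ _ Pa Pb z4 z4, bd _ _ _ _ Qa Qb z4 z4, fun r hr => ?_, ?_⟩
      · simp only [Fin.sum_univ_four, Matrix.cons_val, hb0 r hr]
        rcases P.position_cases hm h0 r with ⟨e1, e2, e3⟩ | ⟨e1, e2, e3⟩ | ⟨e1, e2, e3⟩ <;>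
        rcases Q.position_cases hm h0 r with ⟨f1, f2, f3⟩ | ⟨f1, f2, f3⟩ | ⟨f1, f2, f3⟩ <;>
        norm_num [Position.dist, e1, e2, e3, f1, f2, f3, hnear, hside,
          Q.near_mem_side]
      · simp only [Fin.sum_univ_four, Matrix.cons_val]
        unfold fstCoord sndCoord
        rcases abs_cases ((1 - P.inner - P.outer) / 2 - (1 - Q.inner - Q.outer) / 2) with h | h <;>
        rcases abs_cases ((P.outer - P.inner) / 2 - (Q.outer - Q.inner) / 2) with h' | h' <;>
        rw [h.1, h'.1] <;> norm_num <;> linarith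
    -- the same terminal, reached through different anticliques: the coordinates are crossed
    · have o3 := P.one_le_of_side_ne hm hK h0 Q hnear hside
      refine ⟨![P.fstCoord, P.sndCoord, 0, 0], ![Q.sndCoord, Q.fstCoord, 0, 0],
        bd _ _ _ _ Pa Pb z4 z4, bd _ _ _ _ Qb Qa z4 z4, fun r hr => ?_, ?_⟩
      · simp only [Fin.sum_univ_four, Matrix.cons_val, hb0 r hr]
        have h1 : P.near ∈ Q.side := hnear ▸ Q.near_mem_side
        have h2 : Q.near ∈ P.side := hnear ▸ P.near_mem_side
        rcases P.position_cases hm h0 r with ⟨e1, e2, e3⟩ | ⟨e1, e2, e3⟩ | ⟨e1, e2, e3⟩ <;>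
        rcases Q.position_cases hm h0 r with ⟨f1, f2, f3⟩ | ⟨f1, f2, f3⟩ | ⟨f1, f2, f3⟩ <;>
        norm_num [Position.dist, e1, e2, e3, f1, f2, f3, hnear, hside,
          Q.near_mem_side, h1, h2]
      · simp only [Fin.sum_univ_four, Matrix.cons_val]
        unfold fstCoord sndCoord at p2 q2 ⊢
        rcases abs_cases ((1 - P.inner - P.outer) / 2 - (Q.outer - Q.inner) / 2) with h | h <;>
        rcases abs_cases ((P.outer - P.inner) / 2 - (1 - Q.inner - Q.outer) / 2) with h' | h' <;>
        rw [h.1, h'.1] <;> norm_num <;> linarith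
  by_cases hc : ∃ B ∈ N.anticliques, P.near ∈ B ∧ Q.near ∈ B
  -- different terminals with a common anticlique; the first (second) coordinate of a node that
  -- leans (does not lean) towards it takes part in a match, the other one is compared with `0`
  · have o1 := P.outer_le_inner_add hm Q hnear hc
    have o2 := Q.outer_le_inner_add hm P (Ne.symm hnear) (by simpa only [and_comm] using hc)
    rw [hm.symm y x] at o2
    have hc' := hc
    obtain ⟨B, hB, hPB, hQB⟩ := hc'
    by_cases h1 : P.near ∈ Q.side
    · by_cases h2 : Q.near ∈ P.side
      · have hside : P.side = Q.side := h0.anticlique_unique hnear P.side_mem Q.side_mem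
          P.near_mem_side h2 h1 Q.near_mem_side
        refine ⟨![P.fstCoord, P.sndCoord, 0, 0], ![Q.fstCoord, 0, Q.sndCoord, 0],
          bd _ _ _ _ Pa Pb z4 z4, bd _ _ _ _ Qa z4 Qb z4, fun r hr => ?_, ?_⟩
        · simp only [Fin.sum_univ_four, Matrix.cons_val, hb0 r hr]
          rcases P.position_cases hm h0 r with ⟨e1, e2, e3⟩ | ⟨e1, e2, e3⟩ | ⟨e1, e2, e3⟩ <;>
          rcases Q.position_cases hm h0 r with ⟨f1, f2, f3⟩ | ⟨f1, f2, f3⟩ | ⟨f1, f2, f3⟩ <;>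
          norm_num [Position.dist, e1, e2, e3, f1, f2, f3, hnear,
            hside, h1, hc, Q.near_mem_side]
        · simp only [Fin.sum_univ_four, Matrix.cons_val, sub_zero, zero_sub, abs_neg, abs_zero,
            add_zero, abs_of_nonneg p1, abs_of_nonneg q1]
          unfold fstCoord sndCoord
          rcases abs_cases ((1 - P.inner - P.outer) / 2 - (1 - Q.inner - Q.outer) / 2)
            with h | h <;> rw [h.1] <;> linarith
      · have o3 := Q.one_le_of_common hm hK h0 P (Ne.symm hnear) hB hQB hPB h2
        rw [hm.symm y x] at o3
        have hside : P.side ≠ Q.side := fun h => h2 (h ▸ Q.near_mem_side)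
        refine ⟨![P.fstCoord, P.sndCoord, 0, 0], ![0, Q.fstCoord, Q.sndCoord, 0],
          bd _ _ _ _ Pa Pb z4 z4, bd _ _ _ _ z4 Qa Qb z4, fun r hr => ?_, ?_⟩
        · simp only [Fin.sum_univ_four, Matrix.cons_val, hb0 r hr]
          rcases P.position_cases hm h0 r with ⟨e1, e2, e3⟩ | ⟨e1, e2, e3⟩ | ⟨e1, e2, e3⟩ <;>
          rcases Q.position_cases hm h0 r with ⟨f1, f2, f3⟩ | ⟨f1, f2, f3⟩ | ⟨f1, f2, f3⟩ <;>
          norm_num [Position.dist, e1, e2, e3, f1, f2, f3, hnear,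
            hside, h1, h2, hc]
        · simp only [Fin.sum_univ_four, Matrix.cons_val, sub_zero, zero_sub, abs_neg, abs_zero,
            add_zero, abs_of_nonneg Pa.1, abs_of_nonneg q1]
          unfold fstCoord sndCoord
          rcases abs_cases ((P.outer - P.inner) / 2 - (1 - Q.inner - Q.outer) / 2)
            with h | h <;> rw [h.1] <;> linarith
    · have o3 := P.one_le_of_common hm hK h0 Q hnear hB hPB hQB h1
      have hside : P.side ≠ Q.side := fun h => h1 (h ▸ P.near_mem_side)
      by_cases h2 : Q.near ∈ P.side
      · refine ⟨![P.fstCoord, P.sndCoord, 0, 0], ![Q.sndCoord, 0, Q.fstCoord, 0],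
          bd _ _ _ _ Pa Pb z4 z4, bd _ _ _ _ Qb z4 Qa z4, fun r hr => ?_, ?_⟩
        · simp only [Fin.sum_univ_four, Matrix.cons_val, hb0 r hr]
          rcases P.position_cases hm h0 r with ⟨e1, e2, e3⟩ | ⟨e1, e2, e3⟩ | ⟨e1, e2, e3⟩ <;>
          rcases Q.position_cases hm h0 r with ⟨f1, f2, f3⟩ | ⟨f1, f2, f3⟩ | ⟨f1, f2, f3⟩ <;>
          norm_num [Position.dist, e1, e2, e3, f1, f2, f3, hnear,
            hside, h1, h2, hc]
        · simp only [Fin.sum_univ_four, Matrix.cons_val, sub_zero, zero_sub, abs_neg, abs_zero,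
            add_zero, abs_of_nonneg p1, abs_of_nonneg Qa.1]
          unfold fstCoord sndCoord
          rcases abs_cases ((1 - P.inner - P.outer) / 2 - (Q.outer - Q.inner) / 2)
            with h | h <;> rw [h.1] <;> linarith
      · have o4 := Q.one_le_of_common hm hK h0 P (Ne.symm hnear) hB hQB hPB h2
        rw [hm.symm y x] at o4
        refine ⟨![P.fstCoord, P.sndCoord, 0, 0], ![0, Q.sndCoord, Q.fstCoord, 0],
          bd _ _ _ _ Pa Pb z4 z4, bd _ _ _ _ z4 Qb Qa z4, fun r hr => ?_, ?_⟩
        · simp only [Fin.sum_univ_four, Matrix.cons_val, hb0 r hr]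
          rcases P.position_cases hm h0 r with ⟨e1, e2, e3⟩ | ⟨e1, e2, e3⟩ | ⟨e1, e2, e3⟩ <;>
          rcases Q.position_cases hm h0 r with ⟨f1, f2, f3⟩ | ⟨f1, f2, f3⟩ | ⟨f1, f2, f3⟩ <;>
          norm_num [Position.dist, e1, e2, e3, f1, f2, f3, hnear,
            hside, h1, h2, hc]
        · simp only [Fin.sum_univ_four, Matrix.cons_val, sub_zero, zero_sub, abs_neg, abs_zero,
            add_zero, abs_of_nonneg Pa.1, abs_of_nonneg Qa.1]
          unfold fstCoord sndCoord
          rcases abs_cases ((P.outer - P.inner) / 2 - (Q.outer - Q.inner) / 2)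
            with h | h <;> rw [h.1] <;> linarith
  -- no common anticlique: shortest paths pass through the center, and nothing is matched
  · have o1 := P.one_le_of_not_common hm h0 Q hnear hc
    have h1 : P.near ∉ Q.side := fun h => hc ⟨_, Q.side_mem, h, Q.near_mem_side⟩
    have h2 : Q.near ∉ P.side := fun h => hc ⟨_, P.side_mem, P.near_mem_side, h⟩
    have hside : P.side ≠ Q.side := fun h => h1 (h ▸ P.near_mem_side)
    refine ⟨![P.fstCoord, P.sndCoord, 0, 0], ![0, 0, Q.fstCoord, Q.sndCoord],
      bd _ _ _ _ Pa Pb z4 z4, bd _ _ _ _ z4 z4 Qa Qb, fun r hr => ?_, ?_⟩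
    · simp only [Fin.sum_univ_four, Matrix.cons_val, hb0 r hr]
      rcases P.position_cases hm h0 r with ⟨e1, e2, e3⟩ | ⟨e1, e2, e3⟩ | ⟨e1, e2, e3⟩ <;>
      rcases Q.position_cases hm h0 r with ⟨f1, f2, f3⟩ | ⟨f1, f2, f3⟩ | ⟨f1, f2, f3⟩ <;>
      norm_num [Position.dist, e1, e2, e3, f1, f2, f3, hnear,
        hside, h1, h2, hc]
    · simp only [Fin.sum_univ_four, Matrix.cons_val, sub_zero, zero_sub, abs_neg,
        abs_of_nonneg Pa.1, abs_of_nonneg Qa.1, abs_of_nonneg p1, abs_of_nonneg q1]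
      unfold fstCoord sndCoord
      linarith

theorem position_self (hm : N.IsDualMetric m) (h0 : N.NoZeroPairs) {t : V} (ht : t ∈ N.T)
    (P : Profile N m t) {r : ℝ} (hr : r ≤ 1 / 4) : P.position r = .term t ht := by
  have hself := P.near_le t ht
  rw [hm.self] at hself
  have hnear : P.near = t := by
    by_contra hne
    have h1 := (reward_eq_half_or_one h0 ht P.near_mem (Ne.symm hne)).1
    have h2 := hm.reward_le _ ht _ P.near_mem (Ne.symm hne)
    linarith
  have hinner : P.inner ≤ 0 := (P.inner_le P.near_mem).trans hself
  have h3 := P.half_le_inner_add_outer hm h0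
  have h4 : r ≤ P.sndCoord := by
    unfold sndCoord
    linarith [P.inner_nonneg hm]
  rw [position, if_pos h4]
  congr

end Profile

/-- Every feasible pseudo-metric can be rounded to a map to the frame, at no extra cost. -/
theorem exists_frameMetric_cost_le (hK : N.IsKClutter) (h0 : N.NoZeroPairs) {m : V → V → ℝ}
    (hm : N.IsDualMetric m) : ∃ φ : V → Position N, (∀ t (ht : t ∈ N.T), φ t = .term t ht) ∧
      N.cost (frameMetric φ) ≤ N.cost m := by
  rcases N.T.eq_empty_or_nonempty with hT | hT
  · refine ⟨fun _ => .center, fun t ht => absurd ht (by simp [hT]), cost_mono fun x y _ => ?_⟩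
    simpa [frameMetric, Position.dist] using hm.nonneg x y
  have P : ∀ x, Profile N m x := fun x => (nonempty_profile hT m x).some
  choose α β hα hβ hdist hsum using fun x y => (P x).exists_coordinate_pairs hm hK h0 (P y)
  obtain ⟨r, hr0, hr1, hr⟩ := exists_threshold (J := V × V × Fin 4)
    (c := fun j => (N.mult j.1 j.2.1 : ℝ)) (α := fun j => α j.1 j.2.1 j.2.2)
    (β := fun j => β j.1 j.2.1 j.2.2) (l := 1 / 4) (by norm_num) (fun j => hα _ _ _)
    (fun j => hβ _ _ _)
  refine ⟨fun x => (P x).position r, fun t ht => (P t).position_self hm h0 ht hr1, ?_⟩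
  simp only [Fintype.sum_prod_type, ← Finset.mul_sum] at hr
  calc N.cost (frameMetric fun x => (P x).position r)
      ≤ N.cost fun x y => 1 / 4 * ∑ i, |below r (α x y i) - below r (β x y i)| :=
        cost_mono fun x y _ => mul_le_mul_of_nonneg_left (hdist x y r hr0) (by norm_num)
    _ ≤ N.cost fun x y => ∑ i, |α x y i - β x y i| := by
        rw [cost_const_mul]
        unfold cost
        linarith
    _ ≤ N.cost m := cost_mono fun x y _ => hsum x y

/-! ### Critical expansions -/

/-- Contracting a zero pair to a point keeps a pseudo-metric feasible. -/
theorem IsDualMetric.merge (hK : N.IsKClutter) {m : V → V → ℝ} (hm : N.IsDualMetric m) {s t : V}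
    (hst : N.IsZeroPair s t) :
    N.IsDualMetric fun x y => min (m x y) (min (m x s) (m x t) + min (m y s) (m y t)) := by
  have hs := hst.mem_left
  have ht := hst.symm.mem_left
  have hn := hm.nonneg
  have hh : ∀ x y, min (m x s) (m x t) ≤ m x y + min (m y s) (m y t) := by
    intro x y
    rcases min_choice (m y s) (m y t) with h | h <;> rw [h]
    · exact (min_le_left _ _).trans (hm.triangle _ _ _)
    · exact (min_le_right _ _).trans (hm.triangle _ _ _)
  have hh0 : ∀ x, 0 ≤ min (m x s) (m x t) := fun x => le_min (hn _ _) (hn _ _)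
  refine ⟨fun x => ?_, fun x y => ?_, fun x y z => ?_, fun u hu v hv huv => ?_⟩
  · rw [hm.self]
    exact min_eq_left (add_nonneg (hh0 x) (hh0 x))
  · rw [hm.symm x y, add_comm]
  · have h1 := hh x y
    have h2 := hh z y
    have h3 := hm.triangle x y z
    have h4 := hh0 y
    rw [hm.symm z y] at h2
    rcases min_choice (m x y) (min (m x s) (m x t) + min (m y s) (m y t)) with h | h <;>
    rcases min_choice (m y z) (min (m y s) (m y t) + min (m z s) (m z t)) with h' | h' <;>
    rw [h, h']
    · exact (min_le_left _ _).trans h3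
    · exact (min_le_right _ _).trans (by linarith)
    · exact (min_le_right _ _).trans (by linarith)
    · exact (min_le_right _ _).trans (by linarith)
  · refine le_min (hm.reward_le u hu v hv huv) ?_
    have hmin : ∀ w ∈ N.T, N.rewardMetric w s ≤ min (m w s) (m w t) := by
      intro w hw
      refine le_min (rewardMetric_le hm hw hs) ?_
      rw [rewardMetric_comm, hst.rewardMetric_eq hK hw, rewardMetric_comm]
      exact rewardMetric_le hm hw ht
    have h1 := rewardMetric_triangle hK hu hs hv
    rw [rewardMetric_comm s v] at h1
    rw [rewardMetric, if_neg huv] at h1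
    linarith [hmin u hu, hmin v hv]

/-- Moving a minimum cut around a terminal to the position of that terminal does not raise the cost:
four minus the distance to the terminal in the frame, set to zero outside the cut, is a potential of
height `4`, so by `mul_lam_le_cost` its variation makes up for what the `λ(t)` edges across the cut
may gain. -/
theorem cost_frameMetric_contract_le (h0 : N.NoZeroPairs) {φ : V → Position N} {t : V}
    (ht : t ∈ N.T) {X : Finset V} (hXT : X ∩ N.T = {t}) (hXd : N.d X = N.lam {t}) :
    N.cost (frameMetric fun x => φ (if x ∈ X then t else x)) ≤ N.cost (frameMetric φ) := by
  have h4 : ∀ p q : Position N, p.dist q ≤ 4 := by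
    intro p q
    cases p <;> cases q <;> simp only [Position.dist] <;> first | omega | (split_ifs <;> omega)
  let e : V → ℕ := fun x => if x ∈ X then 4 - (φ t).dist (φ x) else 0
  have htX : t ∈ X := (Finset.mem_inter.mp (hXT ▸ Finset.mem_singleton_self t)).1
  have he := mul_lam_le_cost (N := N) ht e fun s hs hst => if_neg fun hsX =>
    hst (Finset.mem_singleton.mp (hXT ▸ Finset.mem_inter.mpr ⟨hsX, hs⟩))
  have het : (e t : ℝ) = 4 := by simp [e, htX, Position.dist_self]
  have heX : ∀ x ∈ X, (e x : ℝ) = 4 - (φ t).dist (φ x) := by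
    intro x hx
    simp only [e, if_pos hx]
    rw [Nat.cast_sub (h4 _ _)]
    norm_num
  have heX' : ∀ x, x ∉ X → (e x : ℝ) = 0 := by
    intro x hx
    simp only [e, if_neg hx, Nat.cast_zero]
  have htri : ∀ p q r : Position N, (p.dist r : ℝ) ≤ p.dist q + q.dist r := fun p q r => by
    exact_mod_cast Position.dist_triangle h0 p q r
  have hle4 : ∀ x, ((φ t).dist (φ x) : ℝ) ≤ 4 := fun x => by exact_mod_cast h4 _ _
  have hpt : ∀ x y, 4 * frameMetric (fun x => φ (if x ∈ X then t else x)) x y +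
      |(e x : ℝ) - e y| ≤ 4 * frameMetric φ x y + 4 * cutMetric X x y := by
    intro x y
    unfold frameMetric cutMetric
    by_cases hx : x ∈ X <;> by_cases hy : y ∈ X
    · have h1 := htri (φ t) (φ x) (φ y)
      have h2 := htri (φ t) (φ y) (φ x)
      rw [Position.dist_comm (φ y) (φ x)] at h2
      have h3 : |(e x : ℝ) - e y| ≤ (φ x).dist (φ y) := by
        rw [heX x hx, heX y hy, abs_le]; constructor <;> linarith
      simp only [hx, hy, if_true, Position.dist_self]
      norm_num
      linarith
    · have h1 := htri (φ t) (φ x) (φ y)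
      have h3 : |(e x : ℝ) - e y| = 4 - (φ t).dist (φ x) := by
        rw [heX x hx, heX' y hy, sub_zero, abs_of_nonneg]
        linarith [hle4 x]
      simp only [hx, hy, if_true, if_false, h3]
      norm_num
      linarith
    · have h1 := htri (φ x) (φ y) (φ t)
      have h2 := htri (φ t) (φ y) (φ x)
      rw [Position.dist_comm (φ y) (φ x), Position.dist_comm (φ t) (φ x)] at h2
      have h3 : |(e x : ℝ) - e y| = 4 - (φ t).dist (φ y) := by
        rw [heX' x hx, heX y hy, zero_sub, abs_neg, abs_of_nonneg]
        linarith [hle4 y]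
      simp only [hx, hy, if_true, if_false, h3]
      norm_num
      linarith
    · simp [hx, hy, heX' x hx, heX' y hy]
  have hc := cost_mono (N := N) fun x y _ => hpt x y
  rw [cost_add, cost_add, cost_const_mul, cost_const_mul, cost_const_mul, cost_cutMetric,
    hXd] at hc
  rw [het] at he
  linarith

namespace Expansion

variable {𝒳 𝒴 : N.Expansion}

theorem eq_of_mem_members {X Y : Finset V} (hX : X ∈ 𝒳.members) (hY : Y ∈ 𝒳.members) {v : V}
    (hvX : v ∈ X) (hvY : v ∈ Y) : X = Y := by
  by_contra h
  exact Finset.disjoint_left.mp (𝒳.disjoint X hX Y hY h) hvX hvY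

theorem ext_members (h : 𝒳.members = 𝒴.members) : 𝒳 = 𝒴 := by
  cases 𝒳; cases 𝒴; cases h; rfl

theorem isReduced_of_isSimple (hK : N.IsKClutter) (hN : N.IsSimple) (𝒳 : N.Expansion) :
    𝒳.IsReduced := fun s hs t ht h => absurd (hN s hs t ht fun _ hA => h.mem_iff hK hA) h.1

/-- Two members joined by a zero pair can be merged without raising the maximum reward, so a
critical expansion has none. -/
theorem IsCritical.isReduced (hK : N.IsKClutter) (h𝒳 : 𝒳.IsCritical) : 𝒳.IsReduced := by
  intro s hs t ht hst
  obtain ⟨X, hX, hsX⟩ := 𝒳.cover s hs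
  obtain ⟨Y, hY, htY⟩ := 𝒳.cover t ht
  by_cases hXY : X = Y
  · exact ⟨X, hX, hsX, hXY ▸ htY⟩
  exfalso
  have heqs : ∀ u ∈ N.T, u ∈ X ∪ Y → u = s ∨ N.IsZeroPair u s := by
    intro u hu huXY
    by_cases hus : u = s
    · exact Or.inl hus
    refine Or.inr ?_
    rcases Finset.mem_union.mp huXY with h | h
    · exact 𝒳.equi X hX u (Finset.mem_inter.mpr ⟨h, hu⟩) s (Finset.mem_inter.mpr ⟨hsX, hs⟩) hus
    · by_cases hut : u = t
      · exact hut ▸ hst.symm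
      · exact (𝒳.equi Y hY u (Finset.mem_inter.mpr ⟨h, hu⟩) t
          (Finset.mem_inter.mpr ⟨htY, ht⟩) hut).trans hK hst.symm hus
  have hdis : ∀ Z ∈ 𝒳.members \ {X, Y}, Disjoint (X ∪ Y) Z := by
    intro Z hZ
    simp only [Finset.mem_sdiff, Finset.mem_insert, Finset.mem_singleton, not_or] at hZ
    exact Finset.disjoint_union_left.mpr ⟨𝒳.disjoint X hX Z hZ.1 (Ne.symm hZ.2.1),
      𝒳.disjoint Y hY Z hZ.1 (Ne.symm hZ.2.2)⟩
  let 𝒵 : N.Expansion :=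
    { members := insert (X ∪ Y) (𝒳.members \ {X, Y})
      disjoint := by
        intro A hA B hB hAB
        rcases Finset.mem_insert.mp hA with rfl | hA' <;>
        rcases Finset.mem_insert.mp hB with rfl | hB'
        · exact absurd rfl hAB
        · exact hdis B hB'
        · exact (hdis A hA').symm
        · exact 𝒳.disjoint A (Finset.mem_sdiff.mp hA').1 B (Finset.mem_sdiff.mp hB').1 hAB
      nonempty := by
        intro A hA
        rcases Finset.mem_insert.mp hA with rfl | hA
        · exact ⟨s, by simp [hsX, hs]⟩
        · exact 𝒳.nonempty A (Finset.mem_sdiff.mp hA).1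
      cover := by
        intro u hu
        obtain ⟨A, hA, huA⟩ := 𝒳.cover u hu
        by_cases h : A ∈ ({X, Y} : Finset (Finset V))
        · refine ⟨X ∪ Y, Finset.mem_insert_self _ _, ?_⟩
          rw [Finset.mem_insert, Finset.mem_singleton] at h
          rcases h with rfl | rfl
          exacts [Finset.mem_union_left _ huA, Finset.mem_union_right _ huA]
        · exact ⟨A, Finset.mem_insert_of_mem (Finset.mem_sdiff.mpr ⟨hA, h⟩), huA⟩
      equi := by
        intro A hA u hu v hv huv
        rcases Finset.mem_insert.mp hA with rfl | hA
        · rw [Finset.mem_inter] at hu hv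
          rcases heqs u hu.2 hu.1 with rfl | h1
          · rcases heqs v hv.2 hv.1 with rfl | h2
            · exact absurd rfl huv
            · exact h2.symm
          · rcases heqs v hv.2 hv.1 with rfl | h2
            · exact h1
            · exact h1.trans hK h2.symm huv
        · exact 𝒳.equi A (Finset.mem_sdiff.mp hA).1 u hu v hv huv }
  have hprec : 𝒳.Precedes 𝒵 := by
    intro A hA
    by_cases h : A ∈ ({X, Y} : Finset (Finset V))
    · refine ⟨X ∪ Y, Finset.mem_insert_self _ _, ?_⟩
      rw [Finset.mem_insert, Finset.mem_singleton] at h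
      rcases h with rfl | rfl
      exacts [Finset.subset_union_left, Finset.subset_union_right]
    · exact ⟨A, Finset.mem_insert_of_mem (Finset.mem_sdiff.mpr ⟨hA, h⟩), Finset.Subset.refl _⟩
  have hne : 𝒵 ≠ 𝒳 := by
    intro h
    have hmem : X ∪ Y ∈ 𝒳.members := by
      rw [← h]; exact Finset.mem_insert_self _ _
    exact hXY ((eq_of_mem_members hX hmem hsX (Finset.mem_union_left _ hsX)).trans
      (eq_of_mem_members hmem hY (Finset.mem_union_right _ htY) htY))
  obtain ⟨m, hm, hm0, hmc⟩ := 𝒳.exists_isDualMetric_cost_le_theta hK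
  have hle : 𝒵.theta ≤ N.cost _ := 𝒵.theta_le_cost_of_eq_zero hK (hm.merge hK hst) (by
    have hz : ∀ u ∈ X ∪ Y, min (m u s) (m u t) = 0 := by
      intro u hu
      refine le_antisymm ?_ (le_min (hm.nonneg _ _) (hm.nonneg _ _))
      rcases Finset.mem_union.mp hu with h | h
      · exact (min_le_left _ _).trans (hm0 X hX u h s hsX).le
      · exact (min_le_right _ _).trans (hm0 Y hY u h t htY).le
    intro A hA u hu v hv
    rcases Finset.mem_insert.mp hA with rfl | hA
    · rw [hz u hu, hz v hv, add_zero]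
      exact min_eq_right (hm.nonneg _ _)
    · rw [hm0 A (Finset.mem_sdiff.mp hA).1 u hu v hv]
      exact min_eq_left (add_nonneg (le_min (hm.nonneg _ _) (hm.nonneg _ _))
        (le_min (hm.nonneg _ _) (hm.nonneg _ _))))
  have hle2 := cost_mono (N := N) fun x y _ =>
    min_le_left (m x y) (min (m x s) (m x t) + min (m y s) (m y t))
  exact absurd (h𝒳 𝒵 hprec hne) (not_lt.mpr (hle.trans (hle2.trans hmc)))

/-- An optimal dual solution in the network of a critical expansion cannot identify a terminal with
any other node: if it vanishes on disjoint sets `Z a` around the terminals `a`, then these sets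
expand to an expansion above `𝒳` whose maximum is no larger. -/
theorem IsCritical.eq_singleton (hK : N.IsKClutter) (h𝒳 : 𝒳.IsCritical)
    {Z : 𝒳.Node → Finset 𝒳.Node} (hZ : ∀ a ∈ 𝒳.network.T, a ∈ Z a)
    (hdisj : ∀ a ∈ 𝒳.network.T, ∀ b ∈ 𝒳.network.T, a ≠ b → Disjoint (Z a) (Z b))
    {m : 𝒳.Node → 𝒳.Node → ℝ} (hm : 𝒳.network.IsDualMetric m)
    (hm0 : ∀ a ∈ 𝒳.network.T, ∀ x ∈ Z a, ∀ y ∈ Z a, m x y = 0)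
    (hmc : 𝒳.network.cost m ≤ 𝒳.theta) {a : 𝒳.Node} (ha : a ∈ 𝒳.network.T) : Z a = {a} := by
  let U : 𝒳.Node → Finset V := fun a => Finset.univ.filter fun v => 𝒳.toNode v ∈ Z a
  have hU : ∀ {a v}, v ∈ U a ↔ 𝒳.toNode v ∈ Z a := by simp [U]
  have huniq : ∀ a ∈ 𝒳.network.T, ∀ b ∈ 𝒳.network.T, b ∈ Z a → b = a := by
    intro a ha b hb hba
    by_contra hne
    exact Finset.disjoint_left.mp (hdisj b hb a ha hne) (hZ b hb) hba
  let 𝒴 : N.Expansion :=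
    { members := 𝒳.network.T.image U
      disjoint := by
        intro A hA B hB hAB
        obtain ⟨a, ha, rfl⟩ := Finset.mem_image.mp hA
        obtain ⟨b, hb, rfl⟩ := Finset.mem_image.mp hB
        refine Finset.disjoint_left.mpr fun v hv hv' => ?_
        exact Finset.disjoint_left.mp (hdisj a ha b hb fun h => hAB (h ▸ rfl)) (hU.mp hv)
          (hU.mp hv')
      nonempty := by
        intro A hA
        obtain ⟨a, ha, rfl⟩ := Finset.mem_image.mp hA
        obtain ⟨t, ht, rfl⟩ := 𝒳.mem_network_T.mp ha
        exact ⟨t, Finset.mem_inter.mpr ⟨hU.mpr (hZ _ ha), ht⟩⟩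
      cover := fun t ht => ⟨_, Finset.mem_image_of_mem _ (𝒳.toNode_mem_T ht),
        hU.mpr (hZ _ (𝒳.toNode_mem_T ht))⟩
      equi := by
        intro A hA s hs t ht hst
        obtain ⟨a, ha, rfl⟩ := Finset.mem_image.mp hA
        rw [Finset.mem_inter] at hs ht
        have h1 := huniq a ha _ (𝒳.toNode_mem_T hs.2) (hU.mp hs.1)
        have h2 := huniq a ha _ (𝒳.toNode_mem_T ht.2) (hU.mp ht.1)
        exact (𝒳.eq_or_isZeroPair hs.2 ht.2 (h1.trans h2.symm)).resolve_left hst }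
  have hprec : 𝒳.Precedes 𝒴 := by
    intro X hX
    obtain ⟨t, ht⟩ := 𝒳.nonempty X hX
    rw [Finset.mem_inter] at ht
    refine ⟨_, Finset.mem_image_of_mem _ (𝒳.toNode_mem_T ht.2), fun v hv => hU.mpr ?_⟩
    rw [𝒳.toNode_eq_iff.mpr (Or.inr ⟨X, hX, hv, ht.1⟩)]
    exact hZ _ (𝒳.toNode_mem_T ht.2)
  have hle : 𝒴.theta ≤ 𝒳.theta := by
    refine (𝒴.theta_le_cost_of_eq_zero hK (IsDualMetric.comp_toNode 𝒳 hK hm) ?_).trans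
      ((𝒳.network_cost hm.self).ge.trans hmc)
    intro A hA u hu v hv
    obtain ⟨a, ha, rfl⟩ := Finset.mem_image.mp hA
    exact hm0 a ha _ (hU.mp hu) _ (hU.mp hv)
  have heq : 𝒴 = 𝒳 := by
    by_contra hne
    exact absurd (h𝒳 𝒴 hprec hne) (not_lt.mpr hle)
  have hmem : U a ∈ 𝒳.members := heq ▸ (Finset.mem_image_of_mem U ha : U a ∈ 𝒴.members)
  obtain ⟨t, ht, rfl⟩ := 𝒳.mem_network_T.mp ha
  refine Finset.eq_singleton_iff_unique_mem.mpr ⟨hZ _ ha, fun b hb => ?_⟩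
  obtain ⟨v, rfl⟩ := 𝒳.toNode_surjective b
  exact 𝒳.toNode_eq_iff.mpr (Or.inr ⟨_, hmem, hU.mpr hb, hU.mpr (hZ _ ha)⟩)

/-- For critical expansions the min-max formula is tight. -/
theorem IsCritical.value_le_theta (hK : N.IsKClutter) (h𝒳 : 𝒳.IsCritical) :
    𝒳.value ≤ 𝒳.theta := by
  have hK' := 𝒳.network_isKClutter hK
  have h0 := 𝒳.network_noZeroPairs hK (h𝒳.isReduced hK)
  obtain ⟨m, hm, hmc⟩ := 𝒳.network.exists_isDualMetric_cost_le
  obtain ⟨φ, hφ, hφc⟩ := exists_frameMetric_cost_le hK' h0 hm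
  have hc : 𝒳.network.cost (frameMetric φ) ≤ 𝒳.theta := hφc.trans hmc
  rw [value_eq_cutValue]
  refine (cutValue_le_cost_frameMetric h0 hφ ?_ ?_).trans hc
  · intro x t ht hx
    have := h𝒳.eq_singleton hK
      (Z := fun a => Finset.univ.filter fun x => ∃ ha, φ x = .term a ha)
      (fun a ha => Finset.mem_filter.mpr ⟨Finset.mem_univ _, ha, hφ a ha⟩)
      (fun a ha b hb hab => by
        refine Finset.disjoint_left.mpr fun x hx hx' => ?_
        obtain ⟨_, h1⟩ := (Finset.mem_filter.mp hx).2
        obtain ⟨_, h2⟩ := (Finset.mem_filter.mp hx').2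
        rw [h1] at h2
        exact hab (Position.term.inj h2))
      (isDualMetric_frameMetric h0 hφ)
      (fun a ha x hx y hy => by
        obtain ⟨_, h1⟩ := (Finset.mem_filter.mp hx).2
        obtain ⟨_, h2⟩ := (Finset.mem_filter.mp hy).2
        rw [frameMetric, h1, h2, Position.dist_self]
        simp) hc ht
    have hxZ : x ∈ Finset.univ.filter fun x => ∃ ha, φ x = .term t ha :=
      Finset.mem_filter.mpr ⟨Finset.mem_univ _, ht, hx⟩
    rw [this] at hxZ
    exact Finset.mem_singleton.mp hxZ
  · intro t ht
    obtain ⟨X, hXT, hXd⟩ := exists_d_eq_lam (N := 𝒳.network)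
      (Finset.singleton_subset_iff.mpr ht)
    have hXt : ∀ a ∈ 𝒳.network.T, a ∈ X → a = t := fun a ha haX =>
      Finset.mem_singleton.mp (hXT ▸ Finset.mem_inter.mpr ⟨haX, ha⟩)
    have htX : t ∈ X := (Finset.mem_inter.mp (hXT ▸ Finset.mem_singleton_self t)).1
    have := h𝒳.eq_singleton hK (Z := fun a => if a = t then X else {a})
      (m := frameMetric fun x => φ (if x ∈ X then t else x))
      (fun a ha => by
        by_cases h : a = t
        · simp [h, htX]
        · simp [h])
      (fun a ha b hb hab => by
        by_cases h1 : a = t <;> by_cases h2 : b = t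
        · exact absurd (h1.trans h2.symm) hab
        · simpa [h1, h2] using fun h => h2 (hXt b hb h)
        · simpa [h1, h2] using fun h => h1 (hXt a ha h)
        · simpa [h1, h2] using hab)
      (isDualMetric_frameMetric h0 fun a ha => by
        by_cases h : a ∈ X
        · have := hXt a ha h
          subst this
          rw [if_pos h, hφ]
        · rw [if_neg h, hφ])
      (fun a ha x hx y hy => by
        by_cases h : a = t
        · simp only [h, if_true] at hx hy
          simp [frameMetric, hx, hy, Position.dist_self]
        · simp only [h, if_false, Finset.mem_singleton] at hx hy
          simp [frameMetric, hx, hy, Position.dist_self])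
      ((cost_frameMetric_contract_le h0 ht hXT hXd).trans hc) ht
    simp only [if_true] at this
    rw [← hXd, this]

theorem theta_le_value (hK : N.IsKClutter) (h𝒳 : 𝒳.IsReduced) : N.theta ≤ 𝒳.value := by
  rw [value_eq_cutValue]
  exact (𝒳.theta_le_theta hK).trans
    (theta_le_cutValue (𝒳.network_isKClutter hK) (𝒳.network_noZeroPairs hK h𝒳))

/-- The pairs of nodes that lie in a common member; their number grows strictly with the
expansion. -/
def pairs (𝒳 : N.Expansion) : Finset (V × V) :=
  Finset.univ.filter fun e => ∃ X ∈ 𝒳.members, e.1 ∈ X ∧ e.2 ∈ X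

theorem card_pairs_lt (h : 𝒳.Precedes 𝒴) (hne : 𝒴 ≠ 𝒳) : 𝒳.pairs.card < 𝒴.pairs.card := by
  have hsub : 𝒳.pairs ⊆ 𝒴.pairs := by
    intro e he
    obtain ⟨X, hX, h1, h2⟩ := (Finset.mem_filter.mp he).2
    obtain ⟨Y, hY, hXY⟩ := h X hX
    exact Finset.mem_filter.mpr ⟨Finset.mem_univ _, Y, hY, hXY h1, hXY h2⟩
  refine Finset.card_lt_card (hsub.ssubset_of_ne fun heq => hne ?_)
  have key : ∀ X ∈ 𝒳.members, ∀ Y ∈ 𝒴.members, X ⊆ Y → X = Y := by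
    intro X hX Y hY hXY
    refine hXY.antisymm fun v hv => ?_
    obtain ⟨t, ht⟩ := 𝒳.nonempty X hX
    have ht := (Finset.mem_inter.mp ht).1
    have : (t, v) ∈ 𝒳.pairs := by
      rw [heq]
      exact Finset.mem_filter.mpr ⟨Finset.mem_univ _, Y, hY, hXY ht, hv⟩
    obtain ⟨X', hX', h1, h2⟩ := (Finset.mem_filter.mp this).2
    exact eq_of_mem_members hX' hX h1 ht ▸ h2
  refine ext_members (Finset.Subset.antisymm (fun Y hY => ?_) fun X hX => ?_)
  · obtain ⟨t, ht⟩ := 𝒴.nonempty Y hY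
    rw [Finset.mem_inter] at ht
    obtain ⟨X, hX, htX⟩ := 𝒳.cover t ht.2
    obtain ⟨Y', hY', hXY'⟩ := h X hX
    rw [eq_of_mem_members hY hY' ht.1 (hXY' htX), ← key X hX Y' hY' hXY']
    exact hX
  · obtain ⟨Y, hY, hXY⟩ := h X hX
    rw [key X hX Y hY hXY]
    exact hY

/-- The expansion into single terminals. -/
def singletons (N : Network V) : N.Expansion where
  members := N.T.image fun t => {t}
  disjoint := by
    intro X hX Y hY hXY
    obtain ⟨s, _, rfl⟩ := Finset.mem_image.mp hX
    obtain ⟨t, _, rfl⟩ := Finset.mem_image.mp hY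
    exact Finset.disjoint_singleton.mpr fun h => hXY (h ▸ rfl)
  nonempty := by
    intro X hX
    obtain ⟨s, hs, rfl⟩ := Finset.mem_image.mp hX
    exact ⟨s, by simp [hs]⟩
  cover := fun t ht => ⟨{t}, Finset.mem_image_of_mem _ ht, Finset.mem_singleton_self t⟩
  equi := by
    intro X hX s hs t ht hst
    obtain ⟨u, _, rfl⟩ := Finset.mem_image.mp hX
    simp only [Finset.mem_inter, Finset.mem_singleton] at hs ht
    exact absurd (hs.1.trans ht.1.symm) hst

theorem theta_singletons_le (hK : N.IsKClutter) : (singletons N).theta ≤ N.theta := by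
  obtain ⟨m, hm, hmc⟩ := N.exists_isDualMetric_cost_le
  refine ((singletons N).theta_le_cost_of_eq_zero hK hm fun X hX u hu v hv => ?_).trans hmc
  obtain ⟨t, _, rfl⟩ := Finset.mem_image.mp hX
  rw [Finset.mem_singleton] at hu hv
  rw [hu, hv, hm.self]

/-- Dual solutions exist: take an expansion that is maximal among those with `θ_𝒳 = θ`. -/
theorem exists_isDualSolution (hK : N.IsKClutter) : ∃ 𝒳 : N.Expansion, 𝒳.IsDualSolution := by
  have hs := Nat.sSup_mem (s := {k | ∃ 𝒳 : N.Expansion, 𝒳.theta = N.theta ∧ 𝒳.pairs.card = k})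
    ⟨_, singletons N, (theta_singletons_le hK).antisymm ((singletons N).theta_le_theta hK), rfl⟩
    ⟨Fintype.card (V × V), by rintro _ ⟨𝒳, _, rfl⟩; exact Finset.card_le_univ _⟩
  obtain ⟨𝒳, hθ, hcard⟩ := hs
  refine ⟨𝒳, fun 𝒴 hprec hne => ?_, hθ⟩
  rw [hθ]
  refine lt_of_le_of_ne (𝒴.theta_le_theta hK) fun heq => ?_
  have h1 := card_pairs_lt hprec hne
  rw [hcard] at h1
  refine absurd h1 (not_lt.mpr (le_csSup ⟨Fintype.card (V × V), ?_⟩ ⟨𝒴, heq.symm, rfl⟩))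
  rintro _ ⟨𝒳, _, rfl⟩
  exact Finset.card_le_univ _

theorem IsDualSolution.value_eq (hK : N.IsKClutter) (h𝒳 : 𝒳.IsDualSolution) :
    𝒳.value = N.theta :=
  ((h𝒳.1.value_le_theta hK).trans h𝒳.2.le).antisymm (theta_le_value hK (h𝒳.1.isReduced hK))

end Expansion

end

end Network

theorem theorem3 {V : Type*} [Fintype V] (N : Network V) (hN : N.IsKNetwork) :
    -- the maximum of `Θ` exists (and is `θ`)
    IsGreatest {r : ℝ | ∃ f : N.TPath → ℝ, N.IsFlow f ∧ N.reward_flow f = r} N.theta ∧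
    -- for a simple clutter, it is the minimum over all expansions
    (N.IsSimple → IsLeast (Set.range fun 𝒳 : N.Expansion => 𝒳.value) N.theta) ∧
    -- in general, it is the minimum over the expansions that leave no zero pair uncompressed
    IsLeast {r : ℝ | ∃ 𝒳 : N.Expansion, 𝒳.IsReduced ∧ 𝒳.value = r} N.theta ∧
    -- equality holds at every dual solution
    (∀ 𝒳 : N.Expansion, 𝒳.IsDualSolution → 𝒳.value = N.theta) := by
  have hK := hN.2
  obtain ⟨𝒳, h𝒳⟩ := Network.Expansion.exists_isDualSolution hK
  refine ⟨N.isGreatest_theta, fun hS => ⟨⟨𝒳, h𝒳.value_eq hK⟩, ?_⟩,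
    ⟨⟨𝒳, h𝒳.1.isReduced hK, h𝒳.value_eq hK⟩, ?_⟩, fun 𝒴 h𝒴 => h𝒴.value_eq hK⟩
  · rintro _ ⟨𝒴, rfl⟩
    exact Network.Expansion.theta_le_value hK (𝒴.isReduced_of_isSimple hK hS)
  · rintro _ ⟨𝒴, h𝒴, rfl⟩
    exact Network.Expansion.theta_le_value hK h𝒴
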